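/- All graphs are finite and simple. A *partially oriented graph* $X=(V,E\cup A)$ is obtained from a graph (its underlying graph) by orienting some of its edges; $E$ is the set of non-oriented edges $uv$ and $A$ the set of arcs $(u,v)$, also written $u\to v$. An *oriented graph* is one with $E=\emptyset$. It is a *local tournament* if the in-neighbourhood and the out-neighbourhood of each vertex induce tournaments (any two distinct vertices in the set are joined by an arc), and it is *acyclic* if it has no directed cycle. $X$ *can be completed* to an oriented graph $D$ if $D$ arises from $X$ by orienting all edges in $E$. $X$ is an *obstruction for acyclic local tournament orientation completions* if (1) $X$ cannot be completed to an acyclic local tournament; (2) for each $v\in V$, $X-v$ can be completed to an acyclic local tournament; (3) for each $(u,v)\in A$, the partially oriented graph obtained from $X$ by replacing the arc $(u,v)$ by the non-oriented edge $uv$ can be completed to an acyclic local tournament. The *dual* of $X$ is obtained by reversing all arcs of $X$. **Theorem.** Let $X$ be an obstruction for acyclic local tournament orientation completions. Then $X$ or its dual is isomorphic to one of the following partially oriented graphs. Without arcs: - a cycle $C_k$ with $k\ge 4$; - the tent: edges $12,13,23,24,25,35,36,45,56$; - the claw $K_{1,3}$; - the net: a triangle with one pendant vertex attached to each of its vertices.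 With arcs (vertices are numbered from $1$; all edges that are not given as arcs are non-oriented): - (2.i) edges $23,13,24$; arcs $1\to2$, $4\to3$. - (2.ii) edges $23,34,24$; arcs $1\to2$, $3\to1$. - (2.iii) edges $34,45,13,24,35$; arcs $1\to2$, $3\to2$. - (2.iv) edges $45,23,34,24,13$; arcs $1\to2$, $5\to3$. - (2.v) edges $12,23,34,45,35,14$; arcs $1\to3$, $4\to2$. - (2.vi) edges $56,23,45,13,24,35,46,25,14$; arcs $1\to2$, $4\to3$. - (2.vii) edges $12,34,56,13,24,35,46,14,25,36$; arcs $2\to3$, $5\to4$. - (2.viii) the complete graph on $k$ vertices, $k\ge3$, whose arcs are exactly the arcs of one directed Hamiltonian cycle $1\to2\to\cdots\to k\to1$. - (3.i) edges $12,34$; arcs $4\to2$, $2\to3$. - (3.ii) edges $12,45,24$; arcs $2\to3$, $4\to3$. - (3.iii) edges $12,45,13,24,35$; arcs $2\to3$, $4\to3$. - (3.iv) edges $12,56,34,24,35,25$; arcs $2\to3$, $5\to4$. - (3.v) for some $n\ge5$: underlying graph the path $12\cdots n$ together with the edge $24$; arcs $2\to3$, $n\to n-1$. - (3.vi) for some $n\ge3$: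 underlying graph the path $12\cdots n$; arcs $1\to2$, $n\to n-1$. - (3.vii) edges $23,34,45,13,24,35,46$; arcs $1\to2$, $6\to5$. - (3.viii) for some $n\ge7$: underlying graph the path $12\cdots n$ together with the edge joining $2$ and $4$ and the edge joining $n-3$ and $n-1$; arcs $2\to3$, $n-1\to n-2$. -/

import Mathlib

/-- A partially oriented graph on the vertex set `V`: a simple graph (the underlying graph) together
with a choice of direction for some of its edges. The pairs `(u, v)` with `arc u v` are the arcs
(tail `u`, head `v`); the edges of `graph` carrying no arc are the non-oriented edges. -/
structure PartiallyOrientedGraph (V : Type*) where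
  /-- The underlying graph. -/
  graph : SimpleGraph V
  /-- `arc u v`: the edge `uv` is oriented from `u` to `v`. -/
  arc : V → V → Prop
  arc_adj : ∀ u v, arc u v → graph.Adj u v
  arc_asymm : ∀ u v, arc u v → ¬ arc v u

namespace PartiallyOrientedGraph

variable {V W : Type*}

/-- An oriented graph: every edge is oriented. -/
def IsOriented (D : PartiallyOrientedGraph V) : Prop :=
  ∀ u v, D.graph.Adj u v → D.arc u v ∨ D.arc v u

/-- `S` induces a tournament in `D`: any two distinct vertices of `S` are joined by an arc. -/
def InducesTournament (D : PartiallyOrientedGraph V) (S : Set V) : Prop :=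
  ∀ u ∈ S, ∀ v ∈ S, u ≠ v → D.arc u v ∨ D.arc v u

/-- A local tournament: an oriented graph in which the in-neighbourhood as well as the
out-neighbourhood of each vertex induces a tournament. -/
def IsLocalTournament (D : PartiallyOrientedGraph V) : Prop :=
  D.IsOriented ∧
    ∀ v, D.InducesTournament {u | D.arc u v} ∧ D.InducesTournament {u | D.arc v u}

/-- No directed cycle. -/
def IsAcyclic (D : PartiallyOrientedGraph V) : Prop :=
  ∀ v, ¬ Relation.TransGen D.arc v v

/-- `D` is obtained from `X` by orienting all non-oriented edges of `X`. -/
def IsCompletionOf (D X : PartiallyOrientedGraph V) : Prop :=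
  D.graph = X.graph ∧ (∀ u v, X.arc u v → D.arc u v) ∧ D.IsOriented

/-- `X` can be completed to an acyclic local tournament. -/
def Completable (X : PartiallyOrientedGraph V) : Prop :=
  ∃ D : PartiallyOrientedGraph V, D.IsCompletionOf X ∧ D.IsLocalTournament ∧ D.IsAcyclic

/-- `X - v`. -/
def deleteVertex (X : PartiallyOrientedGraph V) (v : V) : PartiallyOrientedGraph {w : V // w ≠ v} where
  graph := X.graph.comap Subtype.val
  arc a b := X.arc a.1 b.1
  arc_adj a b h := X.arc_adj a.1 b.1 h
  arc_asymm a b h := X.arc_asymm a.1 b.1 h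

/-- Replace the arc `(u, v)` by the non-oriented edge `uv`. -/
def unorient (X : PartiallyOrientedGraph V) (u v : V) : PartiallyOrientedGraph V where
  graph := X.graph
  arc a b := X.arc a b ∧ ¬ (a = u ∧ b = v)
  arc_adj a b h := X.arc_adj a b h.1
  arc_asymm a b h h' := X.arc_asymm a b h.1 h'.1

/-- Obstructions for acyclic local tournament orientation completions. -/
def IsObstruction (X : PartiallyOrientedGraph V) : Prop :=
  ¬ X.Completable ∧
    (∀ v, (X.deleteVertex v).Completable) ∧
    (∀ u v, X.arc u v → (X.unorient u v).Completable)

/-- The dual: all arcs are reversed. -/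
def dual (X : PartiallyOrientedGraph V) : PartiallyOrientedGraph V where
  graph := X.graph
  arc a b := X.arc b a
  arc_adj a b h := (X.arc_adj b a h).symm
  arc_asymm a b h := X.arc_asymm b a h

/-- Isomorphism of partially oriented graphs. -/
def Isomorphic (X : PartiallyOrientedGraph V) (Y : PartiallyOrientedGraph W) : Prop :=
  ∃ f : V ≃ W, (∀ u v, X.graph.Adj u v ↔ Y.graph.Adj (f u) (f v)) ∧
    (∀ u v, X.arc u v ↔ Y.arc (f u) (f v))

/-- A graph, regarded as a partially oriented graph without arcs. -/
def ofGraph (G : SimpleGraph V) : PartiallyOrientedGraph V where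
  graph := G
  arc _ _ := False
  arc_adj _ _ h := h.elim
  arc_asymm _ _ h := h.elim

/-- The partially oriented graph whose non-oriented edges are the pairs in `edges`, and whose arcs
are the ordered pairs in `arcs`. -/
def ofLists (n : ℕ) (edges arcs : List (Fin n × Fin n))
    (h : ∀ p ∈ arcs, p.1 ≠ p.2 ∧ (p.2, p.1) ∉ arcs := by decide) :
    PartiallyOrientedGraph (Fin n) where
  graph := SimpleGraph.fromRel fun u v => (u, v) ∈ edges ∨ (u, v) ∈ arcs
  arc u v := (u, v) ∈ arcs
  arc_adj u v huv := by
    rw [SimpleGraph.fromRel_adj]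
    exact ⟨(h _ huv).1, Or.inl (Or.inr huv)⟩
  arc_asymm u v huv := (h _ huv).2

/-! ### The graphs without arcs (besides the cycles) -/

/-- Triangle `1 2 4` with a further vertex adjacent to both ends of each of its sides. -/
def tent : PartiallyOrientedGraph (Fin 6) :=
  ofLists 6 [(0, 1), (0, 2), (1, 2), (1, 3), (1, 4), (2, 4), (2, 5), (3, 4), (4, 5)] []

/-- `K_{1,3}`. -/
def claw : PartiallyOrientedGraph (Fin 4) :=
  ofLists 4 [(0, 1), (0, 2), (0, 3)] []

/-- Triangle with one pendant vertex attached to each vertex. -/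
def net : PartiallyOrientedGraph (Fin 6) :=
  ofLists 6 [(0, 1), (1, 2), (2, 0), (0, 3), (1, 4), (2, 5)] []

/-! ### The graphs with arcs that can be completed to local tournaments

In each definition the first list holds the non-oriented edges and the second the arcs. -/

/-- `K₄` minus the edge `03`, arcs `0 → 1` and `3 → 2`. -/
def diamondDisjoint : PartiallyOrientedGraph (Fin 4) :=
  ofLists 4 [(1, 2), (0, 2), (1, 3)] [(0, 1), (3, 2)]

/-- `K₄` minus the edge `03`, arcs `0 → 1` and `2 → 0`. -/
def diamondShared : PartiallyOrientedGraph (Fin 4) :=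
  ofLists 4 [(1, 2), (2, 3), (1, 3)] [(0, 1), (2, 0)]

/-- The gem with hub `2` and path `0 1 3 4`, arcs `0 → 1` and `2 → 1`. -/
def gemShared : PartiallyOrientedGraph (Fin 5) :=
  ofLists 5 [(2, 3), (3, 4), (0, 2), (1, 3), (2, 4)] [(0, 1), (2, 1)]

/-- The gem with hub `2` and path `0 1 3 4`, arcs `0 → 1` and `4 → 2`. -/
def gemDisjoint : PartiallyOrientedGraph (Fin 5) :=
  ofLists 5 [(3, 4), (1, 2), (2, 3), (1, 3), (0, 2)] [(0, 1), (4, 2)]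

/-- `K₅` minus the edges `04` and `14`, arcs `0 → 2` and `3 → 1`. -/
def fiveVertex : PartiallyOrientedGraph (Fin 5) :=
  ofLists 5 [(0, 1), (1, 2), (2, 3), (3, 4), (2, 4), (0, 3)] [(0, 2), (3, 1)]

/-- `K₆` minus the edges `04`, `05`, `15` and `25`, arcs `0 → 1` and `3 → 2`. -/
def sixVertexA : PartiallyOrientedGraph (Fin 6) :=
  ofLists 6 [(4, 5), (1, 2), (3, 4), (0, 2), (1, 3), (2, 4), (3, 5), (1, 4), (0, 3)]
    [(0, 1), (3, 2)]

/-- `K₆` minus the edges `04`, `05` and `15`, arcs `1 → 2` and `4 → 3`. -/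
def sixVertexB : PartiallyOrientedGraph (Fin 6) :=
  ofLists 6 [(0, 1), (2, 3), (4, 5), (0, 2), (1, 3), (2, 4), (3, 5), (0, 3), (1, 4), (2, 5)]
    [(1, 2), (4, 3)]

/-- The complete graph on `k ≥ 3` vertices whose arcs are exactly the arcs of one directed
Hamiltonian cycle `0 → 1 → ⋯ → k - 1 → 0`. -/
def cyclicClique (k : ℕ) (hk : 3 ≤ k) : PartiallyOrientedGraph (Fin k) where
  graph := ⊤
  arc i j := i.val + 1 = j.val ∨ (i.val + 1 = k ∧ j.val = 0)
  arc_adj i j h := by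
    rw [SimpleGraph.top_adj]
    rintro rfl
    omega
  arc_asymm i j h h' := by omega

/-! ### The graphs with arcs that cannot be completed to local tournaments -/

/-- Triangle `1 2 3` with a pendant vertex `0` attached to `1`, arcs `3 → 1` and `1 → 2`. -/
def pawArcs : PartiallyOrientedGraph (Fin 4) :=
  ofLists 4 [(3, 2), (1, 0)] [(3, 1), (1, 2)]

/-- Triangle `1 2 3` with pendant vertices `0` at `1` and `4` at `3`, arcs `1 → 2` and `3 → 2`. -/
def bullArcs : PartiallyOrientedGraph (Fin 5) :=
  ofLists 5 [(0, 1), (3, 4), (1, 3)] [(1, 2), (3, 2)]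

/-- The gem with hub `2` and path `0 1 3 4`, arcs `1 → 2` and `3 → 2`. -/
def gemCentral : PartiallyOrientedGraph (Fin 5) :=
  ofLists 5 [(0, 1), (3, 4), (0, 2), (1, 3), (2, 4)] [(1, 2), (3, 2)]

/-- `K₄` on `1 2 3 4` with pendant vertices `0` at `1` and `5` at `4`, arcs `1 → 2` and `4 → 3`. -/
def cliquePendants : PartiallyOrientedGraph (Fin 6) :=
  ofLists 6 [(0, 1), (4, 5), (2, 3), (1, 3), (2, 4), (1, 4)] [(1, 2), (4, 3)]

/-- The square of the path `0 1 2 3 4 5`, arcs `0 → 1` and `5 → 4`. -/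
def pathSquare : PartiallyOrientedGraph (Fin 6) :=
  ofLists 6 [(1, 2), (2, 3), (3, 4), (0, 2), (1, 3), (2, 4), (3, 5)] [(0, 1), (5, 4)]

/-- The path `0 1 ⋯ m+2`, arcs `0 → 1` and `m+2 → m+1`. -/
def pathArcs (m : ℕ) : PartiallyOrientedGraph (Fin (m + 3)) where
  graph := SimpleGraph.pathGraph (m + 3)
  arc i j := (i.val = 0 ∧ j.val = 1) ∨ (i.val = m + 2 ∧ j.val = m + 1)
  arc_adj i j h := by
    rw [SimpleGraph.pathGraph_adj]
    omega
  arc_asymm i j h h' := by omega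

/-- The path `0 1 ⋯ m+4` with the additional edge `13`, arcs `1 → 2` and `m+4 → m+3`. -/
def pathOneTriangle (m : ℕ) : PartiallyOrientedGraph (Fin (m + 5)) where
  graph := SimpleGraph.pathGraph (m + 5) ⊔
    SimpleGraph.fromRel fun i j => i.val = 1 ∧ j.val = 3
  arc i j := (i.val = 1 ∧ j.val = 2) ∨ (i.val = m + 4 ∧ j.val = m + 3)
  arc_adj i j h := by
    rw [SimpleGraph.sup_adj, SimpleGraph.pathGraph_adj]
    left
    omega
  arc_asymm i j h h' := by omega

/-- The path `0 1 ⋯ m+6` with the two additional edges joining `1` to `3` and `m+3` to `m+5`,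
arcs `1 → 2` and `m+5 → m+4`. -/
def pathTwoTriangles (m : ℕ) : PartiallyOrientedGraph (Fin (m + 7)) where
  graph := SimpleGraph.pathGraph (m + 7) ⊔
    SimpleGraph.fromRel fun i j =>
      (i.val = 1 ∧ j.val = 3) ∨ (i.val = m + 3 ∧ j.val = m + 5)
  arc i j := (i.val = 1 ∧ j.val = 2) ∨ (i.val = m + 5 ∧ j.val = m + 4)
  arc_adj i j h := by
    rw [SimpleGraph.sup_adj, SimpleGraph.pathGraph_adj]
    left
    omega
  arc_asymm i j h h' := by omega

/-- `X` is a tent, a claw or a net. -/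
def IsTentClawNet (X : PartiallyOrientedGraph V) : Prop :=
  X.Isomorphic tent ∨ X.Isomorphic claw ∨ X.Isomorphic net

/-- `X` is one of the listed graphs with arcs that can be completed to local tournaments. -/
def IsListedLocallyCompletable (X : PartiallyOrientedGraph V) : Prop :=
  X.Isomorphic diamondDisjoint ∨ X.Isomorphic diamondShared ∨
  X.Isomorphic gemShared ∨ X.Isomorphic gemDisjoint ∨
  X.Isomorphic fiveVertex ∨ X.Isomorphic sixVertexA ∨ X.Isomorphic sixVertexB ∨
  ∃ (k : ℕ) (hk : 3 ≤ k), X.Isomorphic (cyclicClique k hk)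

/-- `X` is one of the listed graphs with arcs that cannot be completed to local tournaments. -/
def IsListedNotLocallyCompletable (X : PartiallyOrientedGraph V) : Prop :=
  X.Isomorphic pawArcs ∨ X.Isomorphic bullArcs ∨ X.Isomorphic gemCentral ∨
  X.Isomorphic cliquePendants ∨ (∃ m, X.Isomorphic (pathOneTriangle m)) ∨
  (∃ m, X.Isomorphic (pathArcs m)) ∨ X.Isomorphic pathSquare ∨
  ∃ m, X.Isomorphic (pathTwoTriangles m)

/-- `X` is a cycle `C_k` with `k ≥ 4`, a tent, a claw, a net, or one of the listed graphs with
arcs. -/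
def IsListed (X : PartiallyOrientedGraph V) : Prop :=
  (∃ k, 4 ≤ k ∧ X.Isomorphic (ofGraph (SimpleGraph.cycleGraph k))) ∨
  X.IsTentClawNet ∨ X.IsListedLocallyCompletable ∨ X.IsListedNotLocallyCompletable

end PartiallyOrientedGraph

/-! ### Containment, duality, minimality and connectedness. -/

namespace PartiallyOrientedGraph

variable {V W : Type*}

/-! Completability passes to induced subgraphs and survives forgetting the direction of arcs. Hence
an obstruction that contains, in this sense, a graph without completion is isomorphic to it
(`IsObstruction.isomorphic_of_contains`). Every listed graph is without completion: at a vertex `v`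
two edges to nonadjacent neighbours `u`, `w` must pass through `v`, so directions propagate until
they contradict each other or close a directed cycle. It remains to find a listed graph inside every
obstruction or its dual.

An obstruction is connected. If it contains no cycle of length at least four, claw, net or tent, its
vertices have a straight ordering: an edge `uw` forces all vertices between `u` and `w` to be
adjacent to both (`IsUnobstructed.exists_isStraight`). To get it, one chooses a vertex `z` at an
extreme end of the graph, shows that the distance levels from `z` are cliques, and sorts each level
by neighbourhood inclusion.

Orienting all edges along a straight ordering gives an acyclic local tournament, and vertices with
equal closed neighbourhoods may be permuted freely (`completable_of_isStraight`). So, up to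
reversing the ordering, a completion can fail to exist in two ways only. Either the arcs inside the
classes of equal closed neighbourhoods contain a directed cycle; a shortest one is a directed
Hamiltonian cycle of a clique (`contains_cyclicClique`). Or two arcs between different classes point
in opposite directions with respect to the ordering.

In the second case each of the two arcs has a witness, a vertex adjacent to exactly one of its ends,
so at most six vertices matter. If consecutive ones are adjacent, finitely many configurations
remain, and these are settled by evaluation (`isListed_of_isConfig`). Otherwise a gap separates one
arc and its witness from the other arc and its witness; an increasing induced path across the gap
produces a member of one of the three path families (`isListed_of_far`). -/

/-- `X` contains `Y`: an induced subgraph of `X` becomes isomorphic to `Y` after forgetting the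
direction of some arcs. -/
def Contains (X : PartiallyOrientedGraph V) (Y : PartiallyOrientedGraph W) : Prop :=
  ∃ f : W → V, Function.Injective f ∧ (∀ a b, Y.graph.Adj a b ↔ X.graph.Adj (f a) (f b)) ∧
    ∀ a b, Y.arc a b → X.arc (f a) (f b)

/-- To check that a map is an embedding it is enough to look at increasing pairs. -/
theorem contains_of_lt [LinearOrder W] {X : PartiallyOrientedGraph V}
    {Y : PartiallyOrientedGraph W} (f : W → V)
    (h : ∀ a b, a < b → f a ≠ f b ∧ (Y.graph.Adj a b ↔ X.graph.Adj (f a) (f b)))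
    (harc : ∀ a b, Y.arc a b → X.arc (f a) (f b)) : X.Contains Y := by
  refine ⟨f, ?_, ?_, harc⟩
  · intro a b hab
    rcases lt_trichotomy a b with hl | hl | hl
    · exact absurd hab (h _ _ hl).1
    · exact hl
    · exact absurd hab.symm (h _ _ hl).1
  · intro a b
    rcases lt_trichotomy a b with hl | rfl | hl
    · exact (h _ _ hl).2
    · simp
    · rw [Y.graph.adj_comm, X.graph.adj_comm]
      exact (h _ _ hl).2

/-- A completion is pulled back along the embedding. Being a local tournament is hereditary for
induced subgraphs, and a directed cycle would be mapped to a closed directed walk. -/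
theorem Contains.completable {X : PartiallyOrientedGraph V} {Y : PartiallyOrientedGraph W}
    (h : X.Contains Y) (hX : X.Completable) : Y.Completable := by
  obtain ⟨f, hf, hadj, harc⟩ := h
  obtain ⟨D, ⟨hg, hDX, hor⟩, ⟨-, hloc⟩, hac⟩ := hX
  refine ⟨⟨Y.graph, fun a b => D.arc (f a) (f b), ?_, ?_⟩, ⟨rfl, ?_, ?_⟩, ⟨?_, ?_⟩, ?_⟩
  · intro a b hab
    rw [hadj, ← hg]
    exact D.arc_adj _ _ hab
  · intro a b
    exact D.arc_asymm _ _
  · intro a b hab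
    exact hDX _ _ (harc _ _ hab)
  · intro a b hab
    refine hor _ _ ?_
    rw [hg]
    exact (hadj a b).1 hab
  · intro a b hab
    refine hor _ _ ?_
    rw [hg]
    exact (hadj a b).1 hab
  · intro v
    exact ⟨fun a ha b hb hab => (hloc (f v)).1 _ ha _ hb (hf.ne hab),
      fun a ha b hb hab => (hloc (f v)).2 _ ha _ hb (hf.ne hab)⟩
  · intro v hv
    refine hac (f v) ?_
    exact Relation.TransGen.lift (p := D.arc) f (fun a b hab => hab) _ _ hv

theorem Completable.dual {X : PartiallyOrientedGraph V} (h : X.Completable) :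
    X.dual.Completable := by
  obtain ⟨D, ⟨hg, hDX, hor⟩, ⟨-, hloc⟩, hac⟩ := h
  refine ⟨D.dual, ⟨hg, fun a b hab => hDX b a hab, fun a b hab => (hor a b hab).symm⟩,
    ⟨fun a b hab => (hor a b hab).symm, fun v => ⟨?_, ?_⟩⟩, fun v hv => hac v ?_⟩
  · exact fun a ha b hb hab => ((hloc v).2 a ha b hb hab).symm
  · exact fun a ha b hb hab => ((hloc v).1 a ha b hb hab).symm
  · exact Relation.transGen_swap.1 hv

theorem unorient_dual (X : PartiallyOrientedGraph V) (u v : V) :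
    X.dual.unorient u v = (X.unorient v u).dual := by
  simp only [unorient, dual, mk.injEq, true_and]
  funext a b
  rw [and_comm (a := a = u)]

theorem IsObstruction.dual {X : PartiallyOrientedGraph V} (h : X.IsObstruction) :
    X.dual.IsObstruction := by
  refine ⟨fun h' => h.1 h'.dual, fun v => (h.2.1 v).dual, fun u v huv => ?_⟩
  rw [unorient_dual]
  exact (h.2.2 v u huv).dual

/-- An obstruction that contains a graph without completion is isomorphic to that graph. -/
theorem IsObstruction.isomorphic_of_contains {X : PartiallyOrientedGraph V}
    {Y : PartiallyOrientedGraph W} (hX : X.IsObstruction) (h : X.Contains Y)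
    (hY : ¬ Y.Completable) : X.Isomorphic Y := by
  obtain ⟨f, hf, hadj, harc⟩ := h
  -- A vertex outside the image could be deleted from `X`, and the rest would still contain `Y`.
  have hsurj : Function.Surjective f := by
    intro v
    by_contra! hv
    refine hY (Contains.completable ?_ (hX.2.1 v))
    exact ⟨fun a => ⟨f a, hv a⟩, fun a b hab => hf (congrArg Subtype.val hab), hadj, harc⟩
  -- An arc of `X` that does not come from an arc of `Y` could be unoriented without destroying the
  -- embedding.
  have hiff : ∀ a b, X.arc (f a) (f b) → Y.arc a b := by
    intro a b hab
    by_contra hn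
    refine hY (Contains.completable (X := X.unorient _ _) ⟨f, hf, hadj, ?_⟩ (hX.2.2 _ _ hab))
    intro c d hcd
    refine ⟨harc _ _ hcd, ?_⟩
    rintro ⟨h1, h2⟩
    rw [hf h1, hf h2] at hcd
    exact hn hcd
  let e := Equiv.ofBijective f ⟨hf, hsurj⟩
  have he : ∀ u, f (e.symm u) = u := fun u => e.apply_symm_apply u
  refine ⟨e.symm, fun u v => ?_, fun u v => ?_⟩
  · rw [hadj, he, he]
  · constructor
    · intro h
      apply hiff
      rwa [he, he]
    · intro h
      have := harc _ _ h
      rwa [he, he] at this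

/-- The underlying graph of an obstruction is connected. -/
theorem IsObstruction.preconnected {X : PartiallyOrientedGraph V} (hX : X.IsObstruction) :
    X.graph.Preconnected := by
  classical
  intro p q
  by_contra hpq
  apply hX.1
  let C : Set V := {v | X.graph.Reachable p v}
  have hC : ∀ u v, X.graph.Adj u v → (u ∈ C ↔ v ∈ C) := fun u v huv =>
    ⟨fun h => SimpleGraph.Reachable.trans h huv.reachable,
      fun h => SimpleGraph.Reachable.trans h huv.symm.reachable⟩
  -- A completion of `X - w`, restricted to a set `S` that misses `w`. Used for the component of `p`
  -- with `w = q`, and for its complement with `w = p`; no edge joins the two sets, so the two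
  -- orientations can be united.
  have key : ∀ (S : Set V) (w : V), w ∉ S → ∃ A : V → V → Prop,
      (∀ u v, A u v → u ∈ S ∧ v ∈ S ∧ X.graph.Adj u v ∧ ¬ A v u) ∧
      (∀ u ∈ S, ∀ v ∈ S, X.arc u v → A u v) ∧
      (∀ u ∈ S, ∀ v ∈ S, X.graph.Adj u v → A u v ∨ A v u) ∧
      (∀ v, ∀ a b, A a v → A b v → a ≠ b → A a b ∨ A b a) ∧
      (∀ v, ∀ a b, A v a → A v b → a ≠ b → A a b ∨ A b a) ∧
      (∀ v, ¬ Relation.TransGen A v v) := by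
    intro S w hw
    obtain ⟨D, ⟨hg, hDX, hor⟩, ⟨-, hloc⟩, hac⟩ := hX.2.1 w
    have hne : ∀ u ∈ S, u ≠ w := fun u hu h => hw (h ▸ hu)
    refine ⟨fun u v => ∃ (hu : u ∈ S) (hv : v ∈ S), D.arc ⟨u, hne u hu⟩ ⟨v, hne v hv⟩,
      ?_, ?_, ?_, ?_, ?_, ?_⟩
    · rintro u v ⟨hu, hv, h⟩
      refine ⟨hu, hv, ?_, ?_⟩
      · have := D.arc_adj _ _ h
        rw [hg] at this
        exact this
      · rintro ⟨_, _, h'⟩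
        exact D.arc_asymm _ _ h h'
    · intro u hu v hv h
      exact ⟨hu, hv, hDX _ _ h⟩
    · intro u hu v hv h
      have : D.graph.Adj ⟨u, hne u hu⟩ ⟨v, hne v hv⟩ := by rw [hg]; exact h
      rcases hor _ _ this with h | h
      · exact Or.inl ⟨hu, hv, h⟩
      · exact Or.inr ⟨hv, hu, h⟩
    · rintro v a b ⟨ha, hv, h⟩ ⟨hb, _, h'⟩ hab
      rcases (hloc ⟨v, hne v hv⟩).1 ⟨a, hne a ha⟩ h ⟨b, hne b hb⟩ h'
          (fun e => hab (congrArg Subtype.val e)) with h | h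
      · exact Or.inl ⟨ha, hb, h⟩
      · exact Or.inr ⟨hb, ha, h⟩
    · rintro v a b ⟨hv, ha, h⟩ ⟨_, hb, h'⟩ hab
      rcases (hloc ⟨v, hne v hv⟩).2 ⟨a, hne a ha⟩ h ⟨b, hne b hb⟩ h'
          (fun e => hab (congrArg Subtype.val e)) with h | h
      · exact Or.inl ⟨ha, hb, h⟩
      · exact Or.inr ⟨hb, ha, h⟩
    · intro v hv
      have aux : ∀ x, Relation.TransGen (fun u v => ∃ (hu : u ∈ S) (hv : v ∈ S),
          D.arc ⟨u, hne u hu⟩ ⟨v, hne v hv⟩) v x →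
          ∃ (hv : v ∈ S) (hx : x ∈ S), Relation.TransGen D.arc ⟨v, hne v hv⟩ ⟨x, hne x hx⟩ := by
        intro x hx
        induction hx with
        | single h => exact ⟨h.1, h.2.1, .single h.2.2⟩
        | tail _ h ih =>
          obtain ⟨h1, h2, h3⟩ := ih
          exact ⟨h1, h.2.1, h3.tail h.2.2⟩
      obtain ⟨h1, h2, h3⟩ := aux v hv
      exact hac _ h3
  obtain ⟨A, hA1, hA2, hA3, hA4, hA5, hA6⟩ := key C q hpq
  obtain ⟨B, hB1, hB2, hB3, hB4, hB5, hB6⟩ := key Cᶜ p (fun h => h (SimpleGraph.Reachable.refl p))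
  have hor : ∀ u v, X.graph.Adj u v → (A u v ∨ B u v) ∨ (A v u ∨ B v u) := by
    intro u v huv
    by_cases hu : u ∈ C
    · rcases hA3 u hu v ((hC u v huv).1 hu) huv with h | h <;> simp [h]
    · rcases hB3 u hu v (fun h => hu ((hC u v huv).2 h)) huv with h | h <;> simp [h]
  have hAB : ∀ {u v w}, A u v → B v w → False := fun h h' => (hB1 _ _ h').1 (hA1 _ _ h).2.1
  have hBA : ∀ {u v w}, B u v → A v w → False := fun h h' => (hB1 _ _ h).2.1 (hA1 _ _ h').1
  refine ⟨⟨X.graph, fun u v => A u v ∨ B u v, ?_, ?_⟩, ⟨rfl, ?_, hor⟩, ⟨hor, ?_⟩, ?_⟩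
  · rintro u v (h | h)
    · exact (hA1 _ _ h).2.2.1
    · exact (hB1 _ _ h).2.2.1
  · rintro u v (h | h) (h' | h')
    · exact (hA1 _ _ h).2.2.2 h'
    · exact hAB h h'
    · exact hBA h h'
    · exact (hB1 _ _ h).2.2.2 h'
  · intro u v huv
    by_cases hu : u ∈ C
    · exact Or.inl (hA2 u hu v ((hC u v (X.arc_adj _ _ huv)).1 hu) huv)
    · exact Or.inr (hB2 u hu v (fun h => hu ((hC u v (X.arc_adj _ _ huv)).2 h)) huv)
  · intro v
    constructor
    · rintro a (ha | ha) b (hb | hb) hab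
      · rcases hA4 v a b ha hb hab with h | h <;> simp [h]
      · exact absurd (hA1 _ _ ha).2.1 (hB1 _ _ hb).2.1
      · exact absurd (hA1 _ _ hb).2.1 (hB1 _ _ ha).2.1
      · rcases hB4 v a b ha hb hab with h | h <;> simp [h]
    · rintro a (ha | ha) b (hb | hb) hab
      · rcases hA5 v a b ha hb hab with h | h <;> simp [h]
      · exact absurd (hA1 _ _ ha).1 (hB1 _ _ hb).1
      · exact absurd (hA1 _ _ hb).1 (hB1 _ _ ha).1
      · rcases hB5 v a b ha hb hab with h | h <;> simp [h]
  · intro v hv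
    have aux : ∀ x, Relation.TransGen (fun u v => A u v ∨ B u v) v x →
        Relation.TransGen A v x ∨ Relation.TransGen B v x := by
      intro x hx
      induction hx with
      | single h => exact h.imp .single .single
      | tail _ h ih =>
        rcases ih with ih | ih <;> rcases h with h | h
        · exact Or.inl (ih.tail h)
        · obtain ⟨_, _, h'⟩ := Relation.TransGen.tail'_iff.1 ih
          exact (hAB h' h).elim
        · obtain ⟨_, _, h'⟩ := Relation.TransGen.tail'_iff.1 ih
          exact (hBA h' h).elim
        · exact Or.inr (ih.tail h)
    rcases aux v hv with h | h
    · exact hA6 v h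
    · exact hB6 v h

/-! ### The listed graphs have no completion. -/

instance (n : ℕ) (edges arcs : List (Fin n × Fin n))
    (h : ∀ p ∈ arcs, p.1 ≠ p.2 ∧ (p.2, p.1) ∉ arcs) :
    DecidableRel (ofLists n edges arcs h).graph.Adj := fun u v =>
  decidable_of_iff (u ≠ v ∧ (((u, v) ∈ edges ∨ (u, v) ∈ arcs) ∨ ((v, u) ∈ edges ∨ (v, u) ∈ arcs)))
    (SimpleGraph.fromRel_adj (fun u v => (u, v) ∈ edges ∨ (u, v) ∈ arcs) u v).symm

instance (n : ℕ) (edges arcs : List (Fin n × Fin n))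
    (h : ∀ p ∈ arcs, p.1 ≠ p.2 ∧ (p.2, p.1) ∉ arcs) :
    DecidableRel (ofLists n edges arcs h).arc := fun u v =>
  inferInstanceAs (Decidable ((u, v) ∈ arcs))

/-- Local rules that the arcs of an acyclic local tournament completion obey. -/
theorem not_completable_of_rules {Y : PartiallyOrientedGraph V}
    (H : ∀ a : V → V → Prop, (∀ u v, Y.arc u v → a u v) → (∀ u v, a u v → ¬ a v u) →
      (∀ u v, Y.graph.Adj u v → a u v ∨ a v u) →
      (∀ u v w, Y.graph.Adj v w ∧ ¬ Y.graph.Adj u w ∧ u ≠ w → a u v → a v w) →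
      (∀ u v w, Y.graph.Adj v w ∧ ¬ Y.graph.Adj u w ∧ u ≠ w → a v u → a w v) →
      (∀ v, ¬ Relation.TransGen a v v) → False) :
    ¬ Y.Completable := by
  rintro ⟨D, ⟨hg, hDX, hor⟩, ⟨-, hloc⟩, hac⟩
  have hno : ∀ u w, ¬ Y.graph.Adj u w → ¬ (D.arc u w ∨ D.arc w u) := by
    rintro u w h (h' | h')
    · exact h (hg ▸ D.arc_adj _ _ h')
    · exact h (hg ▸ (D.arc_adj _ _ h').symm)
  refine H D.arc hDX D.arc_asymm (hg ▸ hor) ?_ ?_ hac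
  -- If `w → v` held instead, `u` and `w` would be nonadjacent in-neighbours of `v`. The other rule
  -- is the same for out-neighbours.
  · rintro u v w ⟨hvw, huw, hne⟩ h
    rcases hor v w (hg ▸ hvw) with h' | h'
    · exact h'
    · exact absurd ((hloc v).1 u h w h' hne) (hno u w huw)
  · rintro u v w ⟨hvw, huw, hne⟩ h
    rcases hor v w (hg ▸ hvw) with h' | h'
    · exact absurd ((hloc v).2 u h w h' hne) (hno u w huw)
    · exact h'

/-- For the graphs of fixed size it is enough to use acyclicity on triangles, where it becomes
transitivity. Their proofs below are plain chains of forced directions. -/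
theorem not_completable_of_forced {Y : PartiallyOrientedGraph V}
    (H : ∀ a : V → V → Prop, (∀ u v, Y.arc u v → a u v) → (∀ u v, a u v → ¬ a v u) →
      (∀ u v, Y.graph.Adj u v → a u v ∨ a v u) →
      (∀ u v w, Y.graph.Adj v w ∧ ¬ Y.graph.Adj u w ∧ u ≠ w → a u v → a v w) →
      (∀ u v w, Y.graph.Adj v w ∧ ¬ Y.graph.Adj u w ∧ u ≠ w → a v u → a w v) →
      (∀ u v w, Y.graph.Adj u w → a u v → a v w → a u w) → False) :
    ¬ Y.Completable := by
  refine not_completable_of_rules fun a given asymm tot fwd bwd hac => ?_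
  refine H a given asymm tot fwd bwd fun u v w huw h h' => ?_
  rcases tot u w huw with h'' | h''
  · exact h''
  · exact absurd (((Relation.TransGen.single h).tail h').tail h'') (hac u)

theorem diamondDisjoint_not_completable : ¬ diamondDisjoint.Completable := by
  -- Unfolding to `ofLists` lets `decide` find the decidability instances for adjacency and arcs.
  unfold diamondDisjoint
  refine not_completable_of_forced fun a given asymm tot fwd bwd htr => ?_
  have h01 := given 0 1 (by decide)
  have h32 := given 3 2 (by decide)
  have h20 := fwd 3 2 0 (by decide) h32
  have h13 := fwd 0 1 3 (by decide) h01
  have h12 := htr 1 3 2 (by decide) h13 h32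
  have h02 := htr 0 1 2 (by decide) h01 h12
  exact asymm _ _ h20 h02

theorem diamondShared_not_completable : ¬ diamondShared.Completable := by
  unfold diamondShared
  refine not_completable_of_forced fun a given asymm tot fwd bwd htr => ?_
  have h01 := given 0 1 (by decide)
  have h20 := given 2 0 (by decide)
  have h21 := htr 2 0 1 (by decide) h20 h01
  have h13 := fwd 0 1 3 (by decide) h01
  have h32 := bwd 0 2 3 (by decide) h20
  have h12 := htr 1 3 2 (by decide) h13 h32
  exact asymm _ _ h21 h12

theorem gemShared_not_completable : ¬ gemShared.Completable := by
  unfold gemShared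
  refine not_completable_of_forced fun a given asymm tot fwd bwd htr => ?_
  have h01 := given 0 1 (by decide)
  have h21 := given 2 1 (by decide)
  have h42 := bwd 1 2 4 (by decide) h21
  have h13 := fwd 0 1 3 (by decide) h01
  have h23 := htr 2 1 3 (by decide) h21 h13
  have h34 := fwd 1 3 4 (by decide) h13
  have h24 := htr 2 3 4 (by decide) h23 h34
  exact asymm _ _ h42 h24

theorem gemDisjoint_not_completable : ¬ gemDisjoint.Completable := by
  unfold gemDisjoint
  refine not_completable_of_forced fun a given asymm tot fwd bwd htr => ?_
  have h01 := given 0 1 (by decide)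
  have h42 := given 4 2 (by decide)
  have h21 := fwd 4 2 1 (by decide) h42
  have h13 := fwd 0 1 3 (by decide) h01
  have h20 := fwd 4 2 0 (by decide) h42
  have h32 := bwd 0 2 3 (by decide) h20
  have h12 := htr 1 3 2 (by decide) h13 h32
  exact asymm _ _ h21 h12

theorem fiveVertex_not_completable : ¬ fiveVertex.Completable := by
  unfold fiveVertex
  refine not_completable_of_forced fun a given asymm tot fwd bwd htr => ?_
  have h02 := given 0 2 (by decide)
  have h31 := given 3 1 (by decide)
  have h24 := fwd 0 2 4 (by decide) h02
  have h43 := bwd 1 3 4 (by decide) h31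
  have h12 := bwd 4 2 1 (by decide) h24
  have h32 := htr 3 1 2 (by decide) h31 h12
  have h42 := htr 4 3 2 (by decide) h43 h32
  exact asymm _ _ h24 h42

theorem sixVertexA_not_completable : ¬ sixVertexA.Completable := by
  unfold sixVertexA
  refine not_completable_of_forced fun a given asymm tot fwd bwd htr => ?_
  have h01 := given 0 1 (by decide)
  have h32 := given 3 2 (by decide)
  have h14 := fwd 0 1 4 (by decide) h01
  have h45 := fwd 1 4 5 (by decide) h14
  have h53 := bwd 2 3 5 (by decide) h32
  have h24 := bwd 5 4 2 (by decide) h45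
  have h34 := htr 3 2 4 (by decide) h32 h24
  have h54 := htr 5 3 4 (by decide) h53 h34
  exact asymm _ _ h45 h54

theorem sixVertexB_not_completable : ¬ sixVertexB.Completable := by
  unfold sixVertexB
  refine not_completable_of_forced fun a given asymm tot fwd bwd htr => ?_
  have h12 := given 1 2 (by decide)
  have h43 := given 4 3 (by decide)
  have h30 := fwd 4 3 0 (by decide) h43
  have h25 := fwd 1 2 5 (by decide) h12
  have h02 := bwd 5 2 0 (by decide) h25
  have h32 := htr 3 0 2 (by decide) h30 h02
  have h53 := bwd 0 3 5 (by decide) h30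
  have h23 := htr 2 5 3 (by decide) h25 h53
  exact asymm _ _ h32 h23

theorem pawArcs_not_completable : ¬ pawArcs.Completable := by
  unfold pawArcs
  refine not_completable_of_forced fun a given asymm tot fwd bwd htr => ?_
  have h12 := given 1 2 (by decide)
  have h31 := given 3 1 (by decide)
  have h10 := fwd 3 1 0 (by decide) h31
  have h01 := bwd 2 1 0 (by decide) h12
  exact asymm _ _ h10 h01

theorem bullArcs_not_completable : ¬ bullArcs.Completable := by
  unfold bullArcs
  refine not_completable_of_forced fun a given asymm tot fwd bwd htr => ?_
  have h12 := given 1 2 (by decide)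
  have h32 := given 3 2 (by decide)
  have h43 := bwd 2 3 4 (by decide) h32
  have h31 := fwd 4 3 1 (by decide) h43
  have h01 := bwd 2 1 0 (by decide) h12
  have h13 := fwd 0 1 3 (by decide) h01
  exact asymm _ _ h31 h13

theorem gemCentral_not_completable : ¬ gemCentral.Completable := by
  unfold gemCentral
  refine not_completable_of_forced fun a given asymm tot fwd bwd htr => ?_
  have h12 := given 1 2 (by decide)
  have h32 := given 3 2 (by decide)
  have h24 := fwd 1 2 4 (by decide) h12
  have h20 := fwd 3 2 0 (by decide) h32
  have h42 := bwd 0 2 4 (by decide) h20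
  exact asymm _ _ h24 h42

theorem cliquePendants_not_completable : ¬ cliquePendants.Completable := by
  unfold cliquePendants
  refine not_completable_of_forced fun a given asymm tot fwd bwd htr => ?_
  have h12 := given 1 2 (by decide)
  have h43 := given 4 3 (by decide)
  have h01 := bwd 2 1 0 (by decide) h12
  have h14 := fwd 0 1 4 (by decide) h01
  have h54 := bwd 3 4 5 (by decide) h43
  have h41 := fwd 5 4 1 (by decide) h54
  exact asymm _ _ h14 h41

theorem pathSquare_not_completable : ¬ pathSquare.Completable := by
  unfold pathSquare
  refine not_completable_of_forced fun a given asymm tot fwd bwd htr => ?_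
  have h01 := given 0 1 (by decide)
  have h54 := given 5 4 (by decide)
  have h42 := fwd 5 4 2 (by decide) h54
  have h21 := fwd 4 2 1 (by decide) h42
  have h13 := fwd 0 1 3 (by decide) h01
  have h34 := fwd 1 3 4 (by decide) h13
  have h32 := htr 3 4 2 (by decide) h34 h42
  have h12 := htr 1 3 2 (by decide) h13 h32
  exact asymm _ _ h21 h12

/-- There is no arc to start from, so the direction of `34` is guessed. The two choices force the
directed cycles `1 → 4 → 2 → 0 → 1` and `0 → 2 → 4 → 1 → 0`. -/
theorem tent_not_completable : ¬ tent.Completable := by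
  unfold tent
  refine not_completable_of_forced fun a given asymm tot fwd bwd htr => ?_
  rcases tot 3 4 (by decide) with h34 | h43
  · have h45 := fwd 3 4 5 (by decide) h34
    have h14 := bwd 5 4 1 (by decide) h45
    have h42 := fwd 3 4 2 (by decide) h34
    have h20 := fwd 4 2 0 (by decide) h42
    have h01 := bwd 4 1 0 (by decide) h14
    have h21 := htr 2 0 1 (by decide) h20 h01
    have h41 := htr 4 2 1 (by decide) h42 h21
    exact asymm _ _ h14 h41
  · have h24 := bwd 3 4 2 (by decide) h43
    have h02 := bwd 4 2 0 (by decide) h24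
    have h54 := bwd 3 4 5 (by decide) h43
    have h41 := fwd 5 4 1 (by decide) h54
    have h21 := htr 2 4 1 (by decide) h24 h41
    have h01 := htr 0 2 1 (by decide) h02 h21
    have h10 := fwd 4 1 0 (by decide) h41
    exact asymm _ _ h01 h10

/-- Of any two edges at the centre, one must enter and the other leave; this is impossible for three
edges. -/
theorem claw_not_completable : ¬ claw.Completable := by
  unfold claw
  refine not_completable_of_forced fun a given asymm tot fwd bwd htr => ?_
  rcases tot 0 1 (by decide) with h01 | h10
  · have h30 := bwd 1 0 3 (by decide) h01
    have h20 := bwd 1 0 2 (by decide) h01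
    have h03 := fwd 2 0 3 (by decide) h20
    exact asymm _ _ h30 h03
  · have h03 := fwd 1 0 3 (by decide) h10
    have h02 := fwd 1 0 2 (by decide) h10
    have h30 := bwd 2 0 3 (by decide) h02
    exact asymm _ _ h03 h30

/-- The pendant edge at a triangle vertex forces both triangle edges there to leave it, or both to
enter it. Sources and sinks cannot alternate around a triangle. -/
theorem net_not_completable : ¬ net.Completable := by
  unfold net
  refine not_completable_of_forced fun a given asymm tot fwd bwd htr => ?_
  rcases tot 1 4 (by decide) with h14 | h41
  · have h01 := bwd 4 1 0 (by decide) h14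
    have h30 := bwd 1 0 3 (by decide) h01
    have h02 := fwd 3 0 2 (by decide) h30
    have h21 := bwd 4 1 2 (by decide) h14
    have h52 := bwd 1 2 5 (by decide) h21
    have h20 := fwd 5 2 0 (by decide) h52
    exact asymm _ _ h02 h20
  · have h10 := fwd 4 1 0 (by decide) h41
    have h03 := fwd 1 0 3 (by decide) h10
    have h20 := bwd 3 0 2 (by decide) h03
    have h12 := fwd 4 1 2 (by decide) h41
    have h25 := fwd 1 2 5 (by decide) h12
    have h02 := bwd 5 2 0 (by decide) h25
    exact asymm _ _ h20 h02

/-- The rule "`u → v`, `v ~ w`, `u ≁ w` implies `v → w`" propagates along an induced path. -/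
theorem arc_propagates {G : SimpleGraph V} {a : V → V → Prop}
    (fwd : ∀ u v w, G.Adj v w ∧ ¬ G.Adj u w ∧ u ≠ w → a u v → a v w) (f : ℕ → V) (n : ℕ)
    (hadj : ∀ i, i < n → G.Adj (f (i + 1)) (f (i + 2)) ∧ ¬ G.Adj (f i) (f (i + 2)) ∧
      f i ≠ f (i + 2)) (h0 : a (f 0) (f 1)) : ∀ i, i ≤ n → a (f i) (f (i + 1)) := by
  intro i
  induction i with
  | zero => exact fun _ => h0
  | succ i ih => exact fun hi => fwd _ _ _ (hadj i (by omega)) (ih (by omega))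

theorem transGen_of_steps {a : V → V → Prop} (f : ℕ → V) (n : ℕ)
    (h : ∀ i, i ≤ n → a (f i) (f (i + 1))) : Relation.TransGen a (f 0) (f (n + 1)) := by
  induction n with
  | zero => exact .single (h 0 le_rfl)
  | succ n ih => exact (ih fun i hi => h i (by omega)).tail (h _ le_rfl)

theorem cycleGraph_adj_iff_val {k : ℕ} {u v : Fin k} (hk : 2 ≤ k) :
    (SimpleGraph.cycleGraph k).Adj u v ↔ u.val + 1 = v.val ∨ v.val + 1 = u.val ∨
      (u.val = 0 ∧ v.val + 1 = k) ∨ (v.val = 0 ∧ u.val + 1 = k) := by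
  have key : ∀ a b : Fin k, (a - b).val = 1 ↔ b.val + 1 = a.val ∨ (a.val = 0 ∧ b.val + 1 = k) := by
    intro a b
    rcases le_or_gt b a with h | h
    · rw [Fin.sub_val_of_le h]
      have h : b.val ≤ a.val := h
      omega
    · rw [Fin.coe_sub_iff_lt.2 h]
      have h : a.val < b.val := h
      omega
  rw [SimpleGraph.cycleGraph_adj', key, key]
  tauto

/-- The direction of one edge propagates around the whole cycle and makes it a directed cycle. The
map `f` enumerates the cycle in the sense in which the edge `01` happens to be oriented. -/
theorem cycleGraph_not_completable (k : ℕ) (hk : 4 ≤ k) :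
    ¬ (ofGraph (SimpleGraph.cycleGraph k)).Completable := by
  refine not_completable_of_rules fun a _ _ tot fwd _ hac => ?_
  have key : ∀ f : ℕ → ℕ, (∀ i, i < k → f i < k) →
      (∀ i j, i < j → j < k → f i ≠ f j) →
      (∀ i j, i < j → j < k → ((f i + 1 = f j ∨ f j + 1 = f i ∨
      (f i = 0 ∧ f j + 1 = k) ∨ (f j = 0 ∧ f i + 1 = k)) ↔ j = i + 1 ∨ (i = 0 ∧ j + 1 = k))) →
      (∀ u v : Fin k, u.val = f 0 → v.val = f 1 → a u v) → False := by
    intro f h1 h2 h3 h0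
    let g : ℕ → Fin k := fun i => if h : i < k then ⟨f i, h1 i h⟩ else ⟨0, by omega⟩
    have hg : ∀ i, i < k → (g i).val = f i := fun i hi => by simp [g, hi]
    have hadj : ∀ i j, i < j → j < k → ((ofGraph (SimpleGraph.cycleGraph k)).graph.Adj (g i) (g j) ↔
        j = i + 1 ∨ (i = 0 ∧ j + 1 = k)) := by
      intro i j hij hj
      have := cycleGraph_adj_iff_val (u := g i) (v := g j) (by omega)
      rw [hg i (by omega), hg j hj, h3 i j hij hj] at this
      exact this
    have hne : ∀ i j, i < j → j < k → g i ≠ g j := by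
      intro i j hij hj
      rw [ne_eq, Fin.ext_iff, hg i (by omega), hg j hj]
      exact h2 i j hij hj
    have hp := arc_propagates fwd g (k - 2) (fun i hi => ⟨(hadj _ _ (by omega) (by omega)).2
      (by omega), fun h => by have := (hadj _ _ (by omega) (by omega)).1 h; omega,
      hne _ _ (by omega) (by omega)⟩) (h0 _ _ (hg 0 (by omega)) (hg 1 (by omega)))
    have hlast := fwd (g (k - 2)) (g (k - 1)) (g 0) ⟨
      ((hadj 0 (k - 1) (by omega) (by omega)).2 (by omega)).symm,
      fun h => by have := (hadj _ _ (by omega) (by omega)).1 h.symm; omega,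
      (hne _ _ (by omega) (by omega)).symm⟩ (by
        have := hp (k - 2) le_rfl
        rwa [show k - 2 + 1 = k - 1 by omega] at this)
    have := transGen_of_steps g (k - 2) hp
    rw [show k - 2 + 1 = k - 1 by omega] at this
    exact hac _ (this.tail hlast)
  rcases tot ⟨0, by omega⟩ ⟨1, by omega⟩
    ((cycleGraph_adj_iff_val (by omega)).2 (Or.inl rfl)) with h | h
  · refine key id (fun i hi => hi) (fun i j hij _ => hij.ne) ?_ ?_
    · intro i j hij hj
      simp only [id]
      omega
    · rintro u v hu hv
      rwa [show u = ⟨0, by omega⟩ from Fin.ext hu, show v = ⟨1, by omega⟩ from Fin.ext hv]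
  -- The cycle traversed backwards: `1, 0, k - 1, k - 2, …, 2`.
  · refine key (fun i => if i ≤ 1 then 1 - i else k + 1 - i) ?_ ?_ ?_ ?_
    · intro i hi
      split_ifs <;> omega
    · intro i j hij hj
      split_ifs <;> omega
    · intro i j hij hj
      split_ifs <;> omega
    · rintro u v hu hv
      rwa [show u = ⟨1, by omega⟩ from Fin.ext hu, show v = ⟨0, by omega⟩ from Fin.ext hv]

theorem cyclicClique_not_completable (k : ℕ) (hk : 3 ≤ k) :
    ¬ (cyclicClique k hk).Completable := by
  obtain ⟨n, rfl⟩ : ∃ n, k = n + 3 := ⟨k - 3, by omega⟩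
  refine not_completable_of_rules fun a given _ _ _ _ hac => ?_
  have h1 : Relation.TransGen a (⟨0, by omega⟩ : Fin (n + 3)) ⟨n + 2, by omega⟩ := by
    have := transGen_of_steps (a := a)
      (fun i => if h : i < n + 3 then (⟨i, h⟩ : Fin (n + 3)) else ⟨0, by omega⟩) (n + 1) ?_
    · simpa using this
    · intro i hi
      apply given
      left
      simp [show i < n + 3 by omega, show i < n + 2 by omega]
  exact hac _ (h1.tail (given _ _ (Or.inr ⟨rfl, rfl⟩)))

theorem pathArcs_not_completable (m : ℕ) : ¬ (pathArcs m).Completable := by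
  refine not_completable_of_rules fun a given asymm _ fwd _ _ => ?_
  let f : ℕ → Fin (m + 3) := fun i => if h : i < m + 3 then ⟨i, h⟩ else 0
  have hf : ∀ i, i < m + 3 → (f i).val = i := fun i hi => by simp [f, hi]
  have h := arc_propagates fwd f (m + 1) (fun i hi => ?_)
    (given _ _ (Or.inl ⟨hf 0 (by omega), hf 1 (by omega)⟩)) (m + 1) le_rfl
  · exact asymm _ _ h (given _ _ (Or.inr ⟨hf _ (by omega), hf _ (by omega)⟩))
  · simp only [pathArcs, SimpleGraph.pathGraph_adj, ne_eq, Fin.ext_iff, hf i (by omega),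
      hf (i + 1) (by omega), hf (i + 2) (by omega)]
    exact ⟨Or.inl trivial, by omega, by omega⟩

/-- The arc `1 → 2` forces `0 → 1`, because `0` and `2` are nonadjacent; this forces `1 → 3`, then
`3 → 4`, and the direction runs along the path against the last arc. -/
theorem pathOneTriangle_not_completable (m : ℕ) : ¬ (pathOneTriangle m).Completable := by
  refine not_completable_of_rules fun a given asymm _ fwd bwd _ => ?_
  let f : ℕ → Fin (m + 5) := fun i => if h : i < m + 5 then ⟨i, h⟩ else 0
  have hf : ∀ i, i < m + 5 → (f i).val = i := fun i hi => by simp [f, hi]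
  have hadj : ∀ i j, i < m + 5 → j < m + 5 → ((pathOneTriangle m).graph.Adj (f i) (f j) ↔
      i + 1 = j ∨ j + 1 = i ∨ (i = 1 ∧ j = 3) ∨ (i = 3 ∧ j = 1)) := by
    intro i j hi hj
    simp only [pathOneTriangle, SimpleGraph.sup_adj, SimpleGraph.pathGraph_adj,
      SimpleGraph.fromRel_adj, ne_eq, Fin.ext_iff, hf i hi, hf j hj]
    omega
  have hne : ∀ i j, i < m + 5 → j < m + 5 → i ≠ j → f i ≠ f j := by
    intro i j hi hj hij
    simpa only [ne_eq, Fin.ext_iff, hf i hi, hf j hj] using hij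
  have h12 := given (f 1) (f 2) (Or.inl ⟨hf 1 (by omega), hf 2 (by omega)⟩)
  have h01 := bwd (f 2) (f 1) (f 0) ⟨(hadj _ _ (by omega) (by omega)).2 (by omega),
    fun h => by have := (hadj _ _ (by omega) (by omega)).1 h; omega,
    hne _ _ (by omega) (by omega) (by omega)⟩ h12
  have h13 := fwd (f 0) (f 1) (f 3) ⟨(hadj _ _ (by omega) (by omega)).2 (by omega),
    fun h => by have := (hadj _ _ (by omega) (by omega)).1 h; omega,
    hne _ _ (by omega) (by omega) (by omega)⟩ h01
  have h34 := fwd (f 1) (f 3) (f 4) ⟨(hadj _ _ (by omega) (by omega)).2 (by omega),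
    fun h => by have := (hadj _ _ (by omega) (by omega)).1 h; omega,
    hne _ _ (by omega) (by omega) (by omega)⟩ h13
  have h := arc_propagates fwd (fun i => f (i + 3)) m (fun i hi => ⟨
    (hadj _ _ (by omega) (by omega)).2 (by omega),
    fun h => by have := (hadj _ _ (by omega) (by omega)).1 h; omega,
    hne _ _ (by omega) (by omega) (by omega)⟩) h34 m le_rfl
  exact asymm _ _ h (given _ _ (Or.inr ⟨hf _ (by omega), hf _ (by omega)⟩))

theorem pathTwoTriangles_not_completable (m : ℕ) : ¬ (pathTwoTriangles m).Completable := by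
  refine not_completable_of_rules fun a given asymm _ fwd bwd _ => ?_
  let f : ℕ → Fin (m + 7) := fun i => if h : i < m + 7 then ⟨i, h⟩ else 0
  have hf : ∀ i, i < m + 7 → (f i).val = i := fun i hi => by simp [f, hi]
  have hadj : ∀ i j, i < m + 7 → j < m + 7 → ((pathTwoTriangles m).graph.Adj (f i) (f j) ↔
      i + 1 = j ∨ j + 1 = i ∨ (i = 1 ∧ j = 3) ∨ (i = 3 ∧ j = 1) ∨
        (i = m + 3 ∧ j = m + 5) ∨ (i = m + 5 ∧ j = m + 3)) := by
    intro i j hi hj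
    simp only [pathTwoTriangles, SimpleGraph.sup_adj, SimpleGraph.pathGraph_adj,
      SimpleGraph.fromRel_adj, ne_eq, Fin.ext_iff, hf i hi, hf j hj]
    omega
  have hne : ∀ i j, i < m + 7 → j < m + 7 → i ≠ j → f i ≠ f j := by
    intro i j hi hj hij
    simpa only [ne_eq, Fin.ext_iff, hf i hi, hf j hj] using hij
  have step : ∀ i j k, i < m + 7 → j < m + 7 → k < m + 7 →
      (j + 1 = k ∨ k + 1 = j ∨ (j = 1 ∧ k = 3) ∨ (j = 3 ∧ k = 1) ∨
        (j = m + 3 ∧ k = m + 5) ∨ (j = m + 5 ∧ k = m + 3)) →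
      ¬ (i + 1 = k ∨ k + 1 = i ∨ (i = 1 ∧ k = 3) ∨ (i = 3 ∧ k = 1) ∨
        (i = m + 3 ∧ k = m + 5) ∨ (i = m + 5 ∧ k = m + 3)) → i ≠ k →
      (pathTwoTriangles m).graph.Adj (f j) (f k) ∧
        ¬ (pathTwoTriangles m).graph.Adj (f i) (f k) ∧ f i ≠ f k := fun i j k hi hj hk h1 h2 h3 =>
    ⟨(hadj _ _ hj hk).2 h1, fun h => h2 ((hadj _ _ hi hk).1 h), hne _ _ hi hk h3⟩
  have h12 := given (f 1) (f 2) (Or.inl ⟨hf 1 (by omega), hf 2 (by omega)⟩)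
  have h01 := bwd (f 2) (f 1) (f 0) (step _ _ _ (by omega) (by omega) (by omega) (by omega)
    (by omega) (by omega)) h12
  have h13 := fwd (f 0) (f 1) (f 3) (step _ _ _ (by omega) (by omega) (by omega) (by omega)
    (by omega) (by omega)) h01
  have h34 := fwd (f 1) (f 3) (f 4) (step _ _ _ (by omega) (by omega) (by omega) (by omega)
    (by omega) (by omega)) h13
  -- For `m = 0` the two triangles share the vertex `3`, and `1 → 3` acts on the edge `35` directly.
  -- Otherwise the direction first travels along the path between them.
  have h35 : a (f (m + 3)) (f (m + 5)) := by
    rcases m with _ | m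
    · exact fwd (f 1) (f 3) (f 5) (step _ _ _ (by omega) (by omega) (by omega) (by omega)
        (by omega) (by omega)) h13
    · have h := arc_propagates fwd (fun i => f (i + 3)) m (fun i hi => step _ _ _ (by omega)
        (by omega) (by omega) (by omega) (by omega) (by omega)) h34 m le_rfl
      exact fwd (f (m + 3)) (f (m + 4)) (f (m + 6)) (step _ _ _ (by omega) (by omega) (by omega)
        (by omega) (by omega) (by omega)) h
  have h56 := fwd (f (m + 3)) (f (m + 5)) (f (m + 6)) (step _ _ _ (by omega) (by omega)
    (by omega) (by omega) (by omega) (by omega)) h35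
  have h54 := given (f (m + 5)) (f (m + 4)) (Or.inr ⟨hf _ (by omega), hf _ (by omega)⟩)
  have h65 := bwd (f (m + 4)) (f (m + 5)) (f (m + 6)) (step _ _ _ (by omega) (by omega)
    (by omega) (by omega) (by omega) (by omega)) h54
  exact asymm _ _ h56 h65

/-! ### Induced paths and the structure of graphs without the forbidden arcless graphs. -/

/-- Any two vertices of `C` are joined by a path inside `C`. -/
def Linked (G : SimpleGraph V) (C : Set V) : Prop :=
  ∀ a ∈ C, ∀ b ∈ C, Relation.ReflTransGen (fun u v => G.Adj u v ∧ v ∈ C) a b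

theorem Linked.insert_of_adj {G : SimpleGraph V} {C : Set V} (h : Linked G C) {s c : V} (hc : c ∈ C)
    (hsc : G.Adj s c) : Linked G (insert s C) := by
  have hmono : ∀ {a b}, Relation.ReflTransGen (fun u v => G.Adj u v ∧ v ∈ C) a b →
      Relation.ReflTransGen (fun u v => G.Adj u v ∧ v ∈ insert s C) a b := fun h =>
    Relation.ReflTransGen.mono (fun _ _ h => ⟨h.1, Or.inr h.2⟩) _ _ h
  have h1 : ∀ a ∈ insert s C,
      Relation.ReflTransGen (fun u v => G.Adj u v ∧ v ∈ insert s C) a c := by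
    rintro a (rfl | ha)
    · exact .single ⟨hsc, Or.inr hc⟩
    · exact hmono (h a ha c hc)
  have h2 : ∀ a ∈ insert s C,
      Relation.ReflTransGen (fun u v => G.Adj u v ∧ v ∈ insert s C) c a := by
    rintro a (rfl | ha)
    · exact .single ⟨hsc.symm, Or.inl rfl⟩
    · exact hmono (h c hc a ha)
  exact fun a ha b hb => (h1 a ha).trans (h2 b hb)

theorem linked_singleton (G : SimpleGraph V) (v : V) : Linked G {v} := by
  rintro a rfl b rfl
  exact .refl

theorem Linked.exists_seq {G : SimpleGraph V} {C : Set V} (h : Linked G C) {a b : V} (ha : a ∈ C)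
    (hb : b ∈ C) : ∃ (m : ℕ) (p : ℕ → V), p 0 = a ∧ p m = b ∧ (∀ i ≤ m, p i ∈ C) ∧
      ∀ i < m, G.Adj (p i) (p (i + 1)) := by
  have := h a ha b hb
  clear hb
  induction this with
  | refl => exact ⟨0, fun _ => a, rfl, rfl, fun _ _ => ha, fun i hi => absurd hi (by omega)⟩
  | @tail b c _ hbc ih =>
    obtain ⟨m, p, h0, hm, hC, hadj⟩ := ih
    refine ⟨m + 1, fun i => if i ≤ m then p i else c, by simp [h0], by simp, ?_, ?_⟩
    · intro i hi
      dsimp only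
      split_ifs with h
      · exact hC i h
      · exact hbc.2
    · intro i hi
      rcases Nat.lt_or_ge i m with h | h
      · simpa [h.le, Nat.succ_le_of_lt h] using hadj i h
      · obtain rfl : i = m := by omega
        simpa [hm] using hbc.1

/-- Two vertices with neighbours in a linked set are joined by a path that is induced (except that
its ends may be adjacent) and has its interior in the set. -/
theorem Linked.exists_induced_path {G : SimpleGraph V} {C : Set V} (h : Linked G C) {s t a b : V}
    (ha : a ∈ C) (hsa : G.Adj s a) (hb : b ∈ C) (htb : G.Adj t b) :
    ∃ (m : ℕ) (p : ℕ → V), (∀ i ≤ m, p i ∈ C) ∧ (∀ i ≤ m, G.Adj s (p i) ↔ i = 0) ∧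
      (∀ i ≤ m, G.Adj t (p i) ↔ i = m) ∧
      ∀ i j, i < j → j ≤ m → p i ≠ p j ∧ (G.Adj (p i) (p j) ↔ j = i + 1) := by
  classical
  let P : ℕ → Prop := fun m => ∃ p : ℕ → V, G.Adj s (p 0) ∧ G.Adj t (p m) ∧ (∀ i ≤ m, p i ∈ C) ∧
      ∀ i < m, G.Adj (p i) (p (i + 1))
  have hP : ∃ m, P m := by
    obtain ⟨m, p, rfl, rfl, h1, h2⟩ := h.exists_seq ha hb
    exact ⟨m, p, hsa, htb, h1, h2⟩
  obtain ⟨p, hs, ht, hC, hadj⟩ := Nat.find_spec hP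
  have hmin : ∀ k, P k → Nat.find hP ≤ k := fun k hk => Nat.find_min' hP hk
  generalize Nat.find hP = m at *
  -- All three claims use that the walk is as short as possible: a later neighbour of `s` or an
  -- earlier neighbour of `t` would allow an end to be cut off, and a chord would allow the vertices
  -- between its ends to be skipped.
  have hs' : ∀ i ≤ m, G.Adj s (p i) → i = 0 := by
    intro i hi hsi
    have := hmin (m - i) ⟨fun k => p (i + k), hsi, by simpa [Nat.add_sub_cancel' hi] using ht,
      fun k hk => hC _ (by omega), fun k hk => hadj (i + k) (by omega)⟩
    omega
  have ht' : ∀ i ≤ m, G.Adj t (p i) → i = m := by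
    intro i hi hti
    have := hmin i ⟨p, hs, hti, fun k hk => hC _ (by omega), fun k hk => hadj k (by omega)⟩
    omega
  have hch : ∀ i j, i < j → j ≤ m → G.Adj (p i) (p j) → j = i + 1 := by
    intro i j hij hj hadj'
    by_contra hne
    have := hmin (m - (j - i - 1)) ⟨fun k => if k ≤ i then p k else p (k + (j - i - 1)), ?_, ?_,
      ?_, ?_⟩
    · omega
    · simpa using hs
    · beta_reduce
      rw [if_neg (by omega), show m - (j - i - 1) + (j - i - 1) = m by omega]
      exact ht
    · intro k hk
      dsimp only
      split_ifs
      · exact hC _ (by omega)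
      · exact hC _ (by omega)
    · intro k hk
      beta_reduce
      rcases lt_trichotomy k i with hki | rfl | hki
      · rw [if_pos (by omega), if_pos (by omega)]
        exact hadj k (by omega)
      · rw [if_pos le_rfl, if_neg (by omega), show k + 1 + (j - k - 1) = j by omega]
        exact hadj'
      · rw [if_neg (by omega), if_neg (by omega),
          show k + 1 + (j - i - 1) = k + (j - i - 1) + 1 by omega]
        exact hadj _ (by omega)
  refine ⟨m, p, hC, fun i hi => ⟨hs' i hi, ?_⟩, fun i hi => ⟨ht' i hi, ?_⟩, ?_⟩
  · rintro rfl
    exact hs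
  · rintro rfl
    exact ht
  · intro i j hij hj
    refine ⟨fun he => ?_, hch i j hij hj, ?_⟩
    · rcases Nat.lt_or_ge j m with hjm | hjm
      · have := hch i (j + 1) (by omega) hjm (by rw [he]; exact hadj j hjm)
        omega
      · obtain rfl : j = m := by omega
        have := ht' i (by omega) (he ▸ ht)
        omega
    · rintro rfl
      exact hadj i (by omega)

theorem contains_cycleGraph (X : PartiallyOrientedGraph V) (k : ℕ) (hk : 4 ≤ k) (q : ℕ → V)
    (h : ∀ i j, i < j → j < k → q i ≠ q j ∧
      (X.graph.Adj (q i) (q j) ↔ j = i + 1 ∨ (i = 0 ∧ j + 1 = k))) :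
    X.Contains (ofGraph (SimpleGraph.cycleGraph k)) := by
  refine contains_of_lt (fun i : Fin k => q i.val) (fun a b hab => ?_) (fun _ _ h => h.elim)
  have hab : a.val < b.val := hab
  obtain ⟨h1, h2⟩ := h a.val b.val hab b.isLt
  refine ⟨h1, ?_⟩
  rw [h2]
  refine (cycleGraph_adj_iff_val (by omega)).trans ?_
  omega

/-- `X` contains none of the graphs without arcs. -/
structure IsUnobstructed (X : PartiallyOrientedGraph V) : Prop where
  cycle : ∀ k, 4 ≤ k → ¬ X.Contains (ofGraph (SimpleGraph.cycleGraph k))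
  claw : ¬ X.Contains claw
  net : ¬ X.Contains net
  tent : ¬ X.Contains tent

namespace IsUnobstructed

variable {X : PartiallyOrientedGraph V}

theorem adj_of_claw (hX : X.IsUnobstructed) {c x y w : V} (hx : X.graph.Adj c x)
    (hy : X.graph.Adj c y) (hw : X.graph.Adj c w) (hxw : ¬ X.graph.Adj x w)
    (hyw : ¬ X.graph.Adj y w) (hxw' : x ≠ w) (hyw' : y ≠ w) (hne : x ≠ y) : X.graph.Adj x y := by
  by_contra hxy
  apply hX.claw
  refine contains_of_lt ![c, x, y, w] ?_ (by rintro _ _ ⟨⟩)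
  have := hx.ne; have := hy.ne; have := hw.ne
  simp only [PartiallyOrientedGraph.claw, ofLists, SimpleGraph.fromRel_adj]
  simp [Fin.forall_fin_succ, *]

theorem not_c4 (hX : X.IsUnobstructed) {x y z w : V} (hxy : X.graph.Adj x y)
    (hyz : X.graph.Adj y z) (hzw : X.graph.Adj z w) (hwx : X.graph.Adj w x)
    (hxz : ¬ X.graph.Adj x z) (hyw : ¬ X.graph.Adj y w) (hxz' : x ≠ z) (hyw' : y ≠ w) : False := by
  refine hX.cycle 4 le_rfl (contains_of_lt ![x, y, z, w] ?_ (by rintro _ _ ⟨⟩))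
  have := hxy.ne; have := hyz.ne; have := hzw.ne; have := hwx.ne; have := hwx.symm
  have := hwx.ne'
  simp only [ofGraph, cycleGraph_adj_iff_val (show 2 ≤ 4 by omega)]
  simp [Fin.forall_fin_succ, *]

theorem not_net (hX : X.IsUnobstructed) {a b c a' b' c' : V} (hab : X.graph.Adj a b)
    (hbc : X.graph.Adj b c) (hca : X.graph.Adj c a) (haa : X.graph.Adj a a')
    (hbb : X.graph.Adj b b') (hcc : X.graph.Adj c c') (h1 : ¬ X.graph.Adj a b')
    (h2 : ¬ X.graph.Adj a c') (h3 : ¬ X.graph.Adj b a') (h4 : ¬ X.graph.Adj b c')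
    (h5 : ¬ X.graph.Adj c a') (h6 : ¬ X.graph.Adj c b') (h7 : ¬ X.graph.Adj a' b')
    (h8 : ¬ X.graph.Adj a' c') (h9 : ¬ X.graph.Adj b' c') : False := by
  apply hX.net
  refine contains_of_lt ![a, b, c, a', b', c'] ?_ (by rintro _ _ ⟨⟩)
  -- Distinctness need not be assumed: a coincidence would turn one of the required edges into a
  -- required non-edge.
  have e1 : a ≠ b' := fun h => h7 ((h ▸ haa).symm)
  have e2 : a ≠ c' := fun h => h8 ((h ▸ haa).symm)
  have e3 : b ≠ a' := fun h => h7 (h ▸ hbb)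
  have e4 : b ≠ c' := fun h => h9 ((h ▸ hbb).symm)
  have e5 : c ≠ a' := fun h => h8 (h ▸ hcc)
  have e6 : c ≠ b' := fun h => h9 (h ▸ hcc)
  have e7 : a' ≠ b' := fun h => h1 (h ▸ haa)
  have e8 : a' ≠ c' := fun h => h2 (h ▸ haa)
  have e9 : b' ≠ c' := fun h => h4 (h ▸ hbb)
  have := hab.ne; have := hbc.ne; have := hca.ne'; have := haa.ne; have := hbb.ne
  have := hcc.ne; have := hca.symm
  simp only [PartiallyOrientedGraph.net, ofLists, SimpleGraph.fromRel_adj]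
  simp [Fin.forall_fin_succ, *]

theorem not_tent (hX : X.IsUnobstructed) {a x y b p c : V} (hax : X.graph.Adj a x)
    (hay : X.graph.Adj a y) (hxy : X.graph.Adj x y) (hxb : X.graph.Adj x b)
    (hxp : X.graph.Adj x p) (hyp : X.graph.Adj y p) (hyc : X.graph.Adj y c)
    (hbp : X.graph.Adj b p) (hpc : X.graph.Adj p c) (h1 : ¬ X.graph.Adj a b)
    (h2 : ¬ X.graph.Adj a p) (h3 : ¬ X.graph.Adj a c) (h4 : ¬ X.graph.Adj x c)
    (h5 : ¬ X.graph.Adj y b) (h6 : ¬ X.graph.Adj b c) : False := by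
  apply hX.tent
  refine contains_of_lt ![a, x, y, b, p, c] ?_ (by rintro _ _ ⟨⟩)
  have e1 : a ≠ b := fun h => h5 ((h ▸ hay).symm)
  have e2 : a ≠ p := fun h => h1 ((h ▸ hbp).symm)
  have e3 : a ≠ c := fun h => h4 ((h ▸ hax).symm)
  have e4 : x ≠ c := fun h => h3 (h ▸ hax)
  have e5 : y ≠ b := fun h => h1 (h ▸ hay)
  have e6 : b ≠ c := fun h => h5 (h ▸ hyc)
  have := hax.ne; have := hay.ne; have := hxy.ne; have := hxb.ne; have := hxp.ne
  have := hyp.ne; have := hyc.ne; have := hbp.ne; have := hpc.ne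
  simp only [PartiallyOrientedGraph.tent, ofLists, SimpleGraph.fromRel_adj]
  simp [Fin.forall_fin_succ, *]

end IsUnobstructed

namespace IsUnobstructed

variable {X : PartiallyOrientedGraph V}

/-- There is a vertex whose neighbourhood is a clique and for which the vertices at distance two
form a clique. -/
theorem exists_end [Finite V] [Nonempty V] (hX : X.IsUnobstructed)
    (hconn : X.graph.Preconnected) : ∃ z,
    (∀ a b, X.graph.Adj z a → X.graph.Adj z b → a ≠ b → X.graph.Adj a b) ∧
    (∀ a b a' b', X.graph.Adj z a' → X.graph.Adj z b' → X.graph.Adj a a' → X.graph.Adj b b' →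
      ¬ X.graph.Adj z a → ¬ X.graph.Adj z b → a ≠ z → b ≠ z → a ≠ b → X.graph.Adj a b) := by
  -- Choose `z` and a linked set `C` avoiding the closed neighbourhood of `z`, with `C` as large as
  -- possible; then `z` is as far out as it can be. If `C` is empty, the graph is complete.
  let T := {P : V × Set V // Linked X.graph P.2 ∧ ∀ c ∈ P.2, c ≠ P.1 ∧ ¬ X.graph.Adj P.1 c}
  have : Nonempty T := ⟨⟨(Classical.arbitrary V, ∅), fun a ha => ha.elim, fun c hc => hc.elim⟩⟩
  obtain ⟨⟨⟨z, C⟩, hC, hz⟩, hmax⟩ := Finite.exists_max fun P : T => P.1.2.ncard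
  replace hmax : ∀ z' C', Linked X.graph C' → (∀ c ∈ C', c ≠ z' ∧ ¬ X.graph.Adj z' c) →
      C'.ncard ≤ C.ncard := fun z' C' h h' => hmax ⟨(z', C'), h, h'⟩
  dsimp only at hC hz
  refine ⟨z, ?_⟩
  rcases C.eq_empty_or_nonempty with rfl | ⟨c₀, hc₀⟩
  · have hall : ∀ u v, u ≠ v → X.graph.Adj u v := by
      intro u v huv
      by_contra h
      have := hmax u {v} (linked_singleton _ v) (by rintro c rfl; exact ⟨huv.symm, h⟩)
      simp at this
    exact ⟨fun a b _ _ h => hall a b h, fun a b _ _ _ _ _ _ _ _ _ _ h => hall a b h⟩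
  -- By maximality, a vertex outside `C` with a neighbour in `C` is adjacent to every other vertex
  -- `z'` that could replace `z`; otherwise it could be added to `C`. The outside of `C` thus splits
  -- into vertices with a neighbour in `C` (called `s`, `t`) and those without (called `r`, among
  -- them `z`).
  have hgrow : ∀ z' s c, s ∉ C → c ∈ C → X.graph.Adj s c → (∀ c ∈ C, c ≠ z' ∧ ¬ X.graph.Adj z' c) →
      s ≠ z' → X.graph.Adj z' s := by
    intro z' s c hs hc hsc hz' hsz
    by_contra hn
    have := hmax z' (insert s C) (hC.insert_of_adj hc hsc) (by
      rintro d (rfl | hd)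
      · exact ⟨hsz, hn⟩
      · exact hz' d hd)
    rw [Set.ncard_insert_of_notMem hs] at this
    omega
  have hzC : z ∉ C := fun h => (hz z h).1 rfl
  have hS : ∀ s c, s ∉ C → c ∈ C → X.graph.Adj s c → X.graph.Adj z s := fun s c hs hc hsc =>
    hgrow z s c hs hc hsc hz fun h => (hz c hc).2 (h ▸ hsc)
  have hR : ∀ r s c, r ∉ C → (∀ c ∈ C, ¬ X.graph.Adj r c) → s ∉ C → c ∈ C → X.graph.Adj s c →
      X.graph.Adj r s := fun r s c hr hrC hs hc hsc =>
    hgrow r s c hs hc hsc (fun d hd => ⟨fun h => hr (h ▸ hd), hrC d hd⟩)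
      fun h => hrC c hc (h ▸ hsc)
  obtain ⟨s₀, c₁, hs₀, hc₁, hsc₀⟩ : ∃ s c, s ∉ C ∧ c ∈ C ∧ X.graph.Adj s c := by
    by_contra! hno
    have hreach := (SimpleGraph.reachable_iff_reflTransGen c₀ z).1 (hconn c₀ z)
    have : ∀ v, Relation.ReflTransGen X.graph.Adj c₀ v → v ∈ C := by
      intro v hv
      induction hv with
      | refl => exact hc₀
      | tail _ h ih =>
        by_contra hn
        exact hno _ _ hn ih h.symm
    exact hzC (this z hreach)
  -- Nonadjacent `r`, `r'` would form a claw with centre `s₀` and third leaf `c₁`.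
  have hRR : ∀ r r', r ∉ C → r' ∉ C → (∀ c ∈ C, ¬ X.graph.Adj r c) →
      (∀ c ∈ C, ¬ X.graph.Adj r' c) → r ≠ r' → X.graph.Adj r r' := by
    intro r r' hr hr' hrC hrC' hne
    exact hX.adj_of_claw (hR r s₀ c₁ hr hrC hs₀ hc₁ hsc₀).symm
      (hR r' s₀ c₁ hr' hrC' hs₀ hc₁ hsc₀).symm hsc₀ (hrC _ hc₁) (hrC' _ hc₁)
      (fun h => hr (h ▸ hc₁)) (fun h => hr' (h ▸ hc₁)) hne
  -- If `s` and `t` were nonadjacent, an induced path through `C` between them, closed up by `t, z,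
  -- s`, would be an induced cycle of length `m + 4`.
  have hSS : ∀ s t c d, s ∉ C → t ∉ C → c ∈ C → d ∈ C → X.graph.Adj s c → X.graph.Adj t d →
      s ≠ t → X.graph.Adj s t := by
    intro s t c d hs ht hc hd hsc htd hne
    by_contra hn
    obtain ⟨m, p, hpC, hps, hpt, hpp⟩ := hC.exists_induced_path hc hsc hd htd
    have hzs := hS s c hs hc hsc
    have hzt := hS t d ht hd htd
    refine hX.cycle (m + 4) (by omega) (contains_cycleGraph X (m + 4) (by omega)
      (fun i => if i ≤ m then p i else if i = m + 1 then t else if i = m + 2 then z else s) ?_)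
    intro i j hij hj
    rcases Nat.lt_or_ge m j with hjm | hjm
    · rw [if_neg (show ¬ j ≤ m by omega)]
      rcases Nat.lt_or_ge m i with him | him
      · rw [if_neg (show ¬ i ≤ m by omega)]
        rcases (show (i = m + 1 ∧ j = m + 2) ∨ (i = m + 1 ∧ j = m + 3) ∨
          (i = m + 2 ∧ j = m + 3) by omega) with ⟨rfl, rfl⟩ | ⟨rfl, rfl⟩ | ⟨rfl, rfl⟩
        · simp [hzt.symm, hzt.ne']
        · simp [hne.symm, X.graph.adj_comm t, hn]
        · simp [hzs, hzs.ne]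
      · rw [if_pos him]
        have hne' : ∀ w, w ∉ C → p i ≠ w := fun w hw h => hw (h ▸ hpC i him)
        rcases (show j = m + 1 ∨ j = m + 2 ∨ j = m + 3 by omega) with rfl | rfl | rfl
        · simp only [if_true, X.graph.adj_comm (p i), hpt i him]
          exact ⟨hne' t ht, by omega⟩
        · have := (hz _ (hpC i him)).2
          rw [if_neg (show ¬ m + 2 = m + 1 by omega), if_pos rfl, X.graph.adj_comm]
          exact ⟨hne' z hzC, iff_of_false this (by omega)⟩
        · rw [if_neg (show ¬ m + 3 = m + 1 by omega), if_neg (show ¬ m + 3 = m + 2 by omega),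
            X.graph.adj_comm, hps i him]
          exact ⟨hne' s hs, by omega⟩
    · rw [if_pos (show j ≤ m by omega), if_pos (show i ≤ m by omega), (hpp i j hij hjm).2]
      exact ⟨(hpp i j hij hjm).1, by omega⟩
  have hcases : ∀ r, r ∉ C → (∀ c ∈ C, ¬ X.graph.Adj r c) ∨ ∃ c ∈ C, X.graph.Adj r c := by
    intro r _
    by_cases h : ∃ c ∈ C, X.graph.Adj r c
    · exact Or.inr h
    · push Not at h
      exact Or.inl h
  have hzn : ∀ c ∈ C, ¬ X.graph.Adj z c := fun c hc => (hz c hc).2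
  constructor
  · intro a b ha hb hne
    have haC : a ∉ C := fun h => hzn a h ha
    have hbC : b ∉ C := fun h => hzn b h hb
    rcases hcases a haC with h | ⟨c, hc, h⟩ <;> rcases hcases b hbC with h' | ⟨c', hc', h'⟩
    · exact hRR a b haC hbC h h' hne
    · exact hR a b c' haC h hbC hc' h'
    · exact (hR b a c hbC h' haC hc h).symm
    · exact hSS a b c c' haC hbC hc hc' h h' hne
  · intro a b a' b' hza hzb haa hbb hna hnb haz hbz hne
    -- The vertices outside `C` form a clique containing `z`, so every vertex at distance two from
    -- `z` lies in `C`.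
    have hfar : ∀ a, ¬ X.graph.Adj z a → a ≠ z → a ∈ C := by
      intro a hna haz
      by_contra haC
      rcases hcases a haC with h | ⟨c, hc, h⟩
      · exact hna (hRR z a hzC haC hzn h haz.symm)
      · exact hna (hS a c haC hc h)
    have ha := hfar a hna haz
    have hb := hfar b hnb hbz
    have ha' : a' ∉ C := fun h => hzn a' h hza
    have hb' : b' ∉ C := fun h => hzn b' h hzb
    by_contra hab
    -- A common neighbour of `a`, `b` and `z` would be the centre of a claw.
    have key : ∀ s, X.graph.Adj z s → X.graph.Adj s a → X.graph.Adj s b → False :=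
      fun s hs hsa hsb => hab (hX.adj_of_claw hsa hsb hs.symm (fun h => hna h.symm)
        (fun h => hnb h.symm) haz hbz hne)
    have hne' : a' ≠ b' := fun h => key a' hza haa.symm (h ▸ hbb.symm)
    have hab' : ¬ X.graph.Adj a' b := fun h => key a' hza haa.symm h
    have hba' : ¬ X.graph.Adj b' a := fun h => key b' hzb h hbb.symm
    have hadj := hSS a' b' a b ha' hb' ha hb haa.symm hbb.symm hne'
    -- A common neighbour of `a'` and `b'` in `C` would complete a tent with central triangle `a' b'
    -- p`. Without one, the induced path below has `m ≥ 1` and closes up through the edge `a'b'` to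
    -- a long induced cycle.
    have htent : ∀ p ∈ C, X.graph.Adj a' p → X.graph.Adj b' p → False := by
      intro p hp hap hbp
      have hpa : X.graph.Adj a p := hX.adj_of_claw haa.symm hap hza.symm (fun h => hna h.symm)
        (fun h => hzn p hp h.symm) haz (hz p hp).1 (fun h => hba' (h ▸ hbp))
      have hpb : X.graph.Adj b p := hX.adj_of_claw hbb.symm hbp hzb.symm (fun h => hnb h.symm)
        (fun h => hzn p hp h.symm) hbz (hz p hp).1 (fun h => hab' (h ▸ hap))
      exact hX.not_tent hza hzb hadj haa.symm hap hbp hbb.symm hpa hpb.symm hna (hzn p hp) hnb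
        hab' hba' hab
    obtain ⟨m, p, hpC, hps, hpt, hpp⟩ := hC.exists_induced_path ha haa.symm hb hbb.symm
    have hm : m ≠ 0 := by
      rintro rfl
      exact htent (p 0) (hpC 0 le_rfl) ((hps 0 le_rfl).2 rfl) ((hpt 0 le_rfl).2 rfl)
    refine hX.cycle (m + 3) (by omega) (contains_cycleGraph X (m + 3) (by omega)
      (fun i => if i ≤ m then p i else if i = m + 1 then b' else a') ?_)
    intro i j hij hj
    rcases Nat.lt_or_ge m j with hjm | hjm
    · rw [if_neg (show ¬ j ≤ m by omega)]
      rcases Nat.lt_or_ge m i with him | him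
      · rw [if_neg (show ¬ i ≤ m by omega)]
        obtain ⟨rfl, rfl⟩ : i = m + 1 ∧ j = m + 2 := by omega
        simp [hadj.symm, hadj.ne']
      · rw [if_pos him]
        have hne' : ∀ w, w ∉ C → p i ≠ w := fun w hw h => hw (h ▸ hpC i him)
        rcases (show j = m + 1 ∨ j = m + 2 by omega) with rfl | rfl
        · simp only [if_true, X.graph.adj_comm (p i), hpt i him]
          exact ⟨hne' b' hb', by omega⟩
        · rw [if_neg (show ¬ m + 2 = m + 1 by omega), X.graph.adj_comm, hps i him]
          exact ⟨hne' a' ha', by omega⟩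
    · rw [if_pos (show j ≤ m by omega), if_pos (show i ≤ m by omega), (hpp i j hij hjm).2]
      exact ⟨(hpp i j hij hjm).1, by omega⟩

end IsUnobstructed

/-! ### Straight orderings. -/

/-- A straight ordering: the ends of an edge are adjacent to all vertices between them. -/
def IsStraight [LinearOrder V] (G : SimpleGraph V) : Prop :=
  ∀ u v w, u < v → v < w → G.Adj u w → G.Adj u v ∧ G.Adj v w

/-- If the sets of vertices at a given distance from `z` are cliques in a graph without claws and
four-cycles, then the graph has a straight ordering. -/
theorem IsUnobstructed.exists_isStraight_of_levels [Finite V] {X : PartiallyOrientedGraph V}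
    (hX : X.IsUnobstructed) (lvl : V → ℕ)
    (hadj : ∀ u v, X.graph.Adj u v → lvl v ≤ lvl u + 1)
    (hcl : ∀ u v, lvl u = lvl v → u ≠ v → X.graph.Adj u v) :
    ∃ _ : LinearOrder V, IsStraight X.graph := by
  classical
  -- Neighbours one level further out, and one level closer in. Within a level, vertices are to be
  -- sorted by increasing `Np` and decreasing `Nm`; `key` turns both inclusions into one number.
  let Np : V → Set V := fun v => {w | X.graph.Adj v w ∧ lvl w = lvl v + 1}
  let Nm : V → Set V := fun v => {w | X.graph.Adj v w ∧ lvl w + 1 = lvl v}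
  let key : V → ℕ := fun v => (Np v).ncard + ((Nm v)ᶜ).ncard
  have hlvl : ∀ {a b}, lvl a ≠ lvl b → a ≠ b := fun h h' => h (h' ▸ rfl)
  have hfar : ∀ {a b}, lvl a + 1 < lvl b → ¬ X.graph.Adj a b := fun h h' => by
    have := hadj _ _ h'
    omega
  -- Incomparable sets would give an induced four-cycle through `u`, `v` and a private neighbour of
  -- each; likewise for `Nm`.
  have hp : ∀ u v, lvl u = lvl v → Np u ⊆ Np v ∨ Np v ⊆ Np u := by
    intro u v huv
    by_contra! h
    obtain ⟨⟨a, ha, ha'⟩, ⟨b, hb, hb'⟩⟩ := And.intro (Set.not_subset.1 h.1) (Set.not_subset.1 h.2)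
    have h1 : ¬ X.graph.Adj v a := fun h => ha' ⟨h, by rw [ha.2, huv]⟩
    have h2 : ¬ X.graph.Adj u b := fun h => hb' ⟨h, by rw [hb.2, huv]⟩
    have hab : a ≠ b := fun h => h2 (h ▸ ha.1)
    exact hX.not_c4 (hcl u v huv fun h => h1 (h ▸ ha.1)) hb.1
      (hcl a b (by rw [ha.2, hb.2, huv]) hab).symm ha.1.symm h2 h1
      (hlvl (by rw [hb.2]; omega)) (hlvl (by rw [ha.2]; omega))
  have hm : ∀ u v, lvl u = lvl v → Nm u ⊆ Nm v ∨ Nm v ⊆ Nm u := by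
    intro u v huv
    by_contra! h
    obtain ⟨⟨a, ha, ha'⟩, ⟨b, hb, hb'⟩⟩ := And.intro (Set.not_subset.1 h.1) (Set.not_subset.1 h.2)
    have h1 : ¬ X.graph.Adj v a := fun h => ha' ⟨h, by rw [ha.2, huv]⟩
    have h2 : ¬ X.graph.Adj u b := fun h => hb' ⟨h, by rw [hb.2, huv]⟩
    have hab : a ≠ b := fun h => h2 (h ▸ ha.1)
    have ha2 := ha.2
    have hb2 := hb.2
    exact hX.not_c4 (hcl u v huv fun h => h1 (h ▸ ha.1)) hb.1
      (hcl a b (by omega) hab).symm ha.1.symm h2 h1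
      (hlvl (by omega)) (hlvl (by omega))
  -- Otherwise `u` is the centre of a claw formed by `v` and private neighbours of `u` one level out
  -- and one level in. This makes the two inclusions run in opposite directions.
  have hpm : ∀ u v, lvl u = lvl v → Np u ⊆ Np v ∨ Nm u ⊆ Nm v := by
    intro u v huv
    by_contra! h
    obtain ⟨⟨a, ha, ha'⟩, ⟨b, hb, hb'⟩⟩ := And.intro (Set.not_subset.1 h.1) (Set.not_subset.1 h.2)
    have h1 : ¬ X.graph.Adj v a := fun h => ha' ⟨h, by rw [ha.2, huv]⟩
    have h2 : ¬ X.graph.Adj v b := fun h => hb' ⟨h, by rw [← huv, hb.2]⟩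
    have huv' : u ≠ v := fun h => h1 (h ▸ ha.1)
    have ha2 := ha.2
    have hb2 := hb.2
    refine hfar (by omega) (hX.adj_of_claw hb.1 ha.1 (hcl u v huv huv') (fun h => h2 h.symm)
      (fun h => h1 h.symm) (hlvl (by omega)) (hlvl (by omega)) (hlvl (by omega)))
  have hcomp : ∀ u v, lvl u = lvl v →
      (Np u ⊆ Np v ∧ Nm v ⊆ Nm u) ∨ (Np v ⊆ Np u ∧ Nm u ⊆ Nm v) := by
    intro u v huv
    have := hp u v huv
    have := hm u v huv
    have := hpm u v huv
    have := hpm v u huv.symm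
    tauto
  have hkey : ∀ u v, lvl u = lvl v → key u ≤ key v → Np u ⊆ Np v ∧ Nm v ⊆ Nm u := by
    intro u v huv hle
    rcases hcomp u v huv with h | ⟨h1, h2⟩
    · exact h
    · have h3 := Set.ncard_le_ncard h1
      have h4 := Set.ncard_le_ncard (Set.compl_subset_compl.2 h2)
      have hle : (Np u).ncard + ((Nm u)ᶜ).ncard ≤ (Np v).ncard + ((Nm v)ᶜ).ncard := hle
      have h5 := Set.eq_of_subset_of_ncard_le h1 (by omega)
      have h6 := Set.eq_of_subset_of_ncard_le (Set.compl_subset_compl.2 h2) (by omega)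
      exact ⟨h5.symm.subset, Set.compl_subset_compl.1 h6.symm.subset⟩
  -- Lexicographic order by level, then `key`; the arbitrary enumeration `e` only breaks ties.
  obtain ⟨n, ⟨e⟩⟩ := Finite.exists_equiv_fin V
  let L : LinearOrder V := LinearOrder.lift'
    (fun v => toLex (lvl v, toLex (key v, e v)) : V → ℕ ×ₗ ℕ ×ₗ Fin n) (fun u v huv => by
      have := congrArg (fun x => (ofLex (ofLex x).2).2) huv
      exact e.injective this)
  have hlt : ∀ {u v : V}, u < v → lvl u < lvl v ∨ (lvl u = lvl v ∧ key u ≤ key v) := by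
    intro u v huv
    have huv : toLex (lvl u, toLex (key u, e u)) < toLex (lvl v, toLex (key v, e v)) := huv
    rw [Prod.Lex.toLex_lt_toLex] at huv
    rcases huv with h | ⟨h, h'⟩
    · exact Or.inl h
    · rw [Prod.Lex.toLex_lt_toLex] at h'
      rcases h' with h' | h'
      · exact Or.inr ⟨h, h'.le⟩
      · exact Or.inr ⟨h, h'.1.le⟩
  refine ⟨L, fun u v w huv hvw huw => ?_⟩
  have hle := hadj u w huw
  -- The levels of `u` and `w` differ by at most one, so `v` shares a level with one of them; the
  -- inclusions in that level carry the edge over to `v`.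
  rcases hlt huv with h1 | ⟨h1, k1⟩ <;> rcases hlt hvw with h2 | ⟨h2, k2⟩
  · omega
  · refine ⟨?_, hcl v w h2 hvw.ne⟩
    have : u ∈ Nm w := ⟨huw.symm, by omega⟩
    exact ((hkey v w h2 k2).2 this).1.symm
  · refine ⟨hcl u v h1 huv.ne, ?_⟩
    have : w ∈ Np u := ⟨huw, by omega⟩
    exact ((hkey u v h1 k1).1 this).1
  · exact ⟨hcl u v h1 huv.ne, hcl v w h2 hvw.ne⟩

/-- A connected graph without induced cycle of length at least four, claw, net and tent has a
straight ordering. -/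
theorem IsUnobstructed.exists_isStraight [Finite V] {X : PartiallyOrientedGraph V}
    (hX : X.IsUnobstructed) (hconn : X.graph.Preconnected) :
    ∃ _ : LinearOrder V, IsStraight X.graph := by
  rcases isEmpty_or_nonempty V with hV | hV
  · obtain ⟨n, ⟨e⟩⟩ := Finite.exists_equiv_fin V
    exact ⟨LinearOrder.lift' e e.injective, fun u => hV.elim u⟩
  obtain ⟨z, hz1, hz2⟩ := hX.exists_end hconn
  have hc : X.graph.Connected := ⟨hconn⟩
  have hadj : ∀ u v, X.graph.Adj u v → X.graph.dist z v ≤ X.graph.dist z u + 1 := by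
    intro u v huv
    have := hc.dist_triangle (u := z) (v := u) (w := v)
    rwa [SimpleGraph.dist_eq_one_iff_adj.2 huv] at this
  have hpred : ∀ n v, X.graph.dist z v = n + 1 → ∃ u, X.graph.Adj v u ∧ X.graph.dist z u = n := by
    intro n v hv
    obtain ⟨p, hp⟩ := hc.exists_walk_length_eq_dist v z
    rw [SimpleGraph.dist_comm, hv] at hp
    cases p with
    | nil => simp at hp
    | @cons _ u _ h p =>
      refine ⟨u, h, ?_⟩
      have h1 := SimpleGraph.dist_le p
      have h2 := hadj u v h.symm
      rw [SimpleGraph.Walk.length_cons] at hp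
      rw [SimpleGraph.dist_comm] at h1
      omega
  refine hX.exists_isStraight_of_levels (X.graph.dist z) hadj ?_
  have hne : ∀ {a b}, X.graph.dist z a ≠ X.graph.dist z b → a ≠ b := fun h h' => h (h' ▸ rfl)
  have hfar : ∀ {a b}, X.graph.dist z a + 1 < X.graph.dist z b → ¬ X.graph.Adj b a := fun h h' => by
    have := hadj _ _ h'.symm
    omega
  -- Induction on the distance from `z`. Distances one and two are covered by the choice of `z`.
  -- From distance three on, a common neighbour of nonadjacent `a`, `b` one level closer would give
  -- a claw, a common predecessor of `a'` and `b'` a net, and different predecessors an induced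
  -- four-cycle.
  have key : ∀ n a b, X.graph.dist z a = n → X.graph.dist z b = n → a ≠ b → X.graph.Adj a b := by
    intro n
    induction n using Nat.strong_induction_on with
    | _ n ih =>
    intro a b ha hb hab
    rcases n with _ | _ | n
    · rw [hc.dist_eq_zero_iff] at ha hb
      exact absurd (ha.symm.trans hb) hab
    · exact hz1 a b (SimpleGraph.dist_eq_one_iff_adj.1 ha) (SimpleGraph.dist_eq_one_iff_adj.1 hb)
        hab
    obtain ⟨a', haa, ha'⟩ := hpred _ a ha
    obtain ⟨b', hbb, hb'⟩ := hpred _ b hb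
    rcases n with _ | n
    · have hz : X.graph.dist z z = 0 := SimpleGraph.dist_self
      exact hz2 a b a' b' (SimpleGraph.dist_eq_one_iff_adj.1 ha')
        (SimpleGraph.dist_eq_one_iff_adj.1 hb') haa hbb
        (fun h => by rw [SimpleGraph.dist_eq_one_iff_adj.2 h] at ha; omega)
        (fun h => by rw [SimpleGraph.dist_eq_one_iff_adj.2 h] at hb; omega)
        (hne (by omega)) (hne (by omega)) hab
    by_contra hn
    have hclaw : ∀ c, X.graph.dist z c = n + 2 → X.graph.Adj a c → X.graph.Adj b c → False := by
      intro c hcl hac hbc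
      obtain ⟨d, hcd, hd⟩ := hpred _ c hcl
      exact hn (hX.adj_of_claw hac.symm hbc.symm hcd (hfar (by omega)) (hfar (by omega))
        (hne (by omega)) (hne (by omega)) hab)
    have hab' : a' ≠ b' := fun h => hclaw a' ha' haa (h ▸ hbb)
    have hadj' := ih (n + 2) (by omega) a' b' ha' hb' hab'
    have hab1 : ¬ X.graph.Adj a b' := fun h => hclaw b' hb' h hbb
    have hba1 : ¬ X.graph.Adj b a' := fun h => hclaw a' ha' haa h
    have hnet : ∀ e, X.graph.dist z e = n + 1 → X.graph.Adj a' e → X.graph.Adj b' e → False := by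
      intro e he hae hbe
      obtain ⟨f, hef, hf⟩ := hpred _ e he
      exact hX.not_net hadj' hbe hae.symm haa.symm hbb.symm hef (fun h => hba1 h.symm)
        (hfar (by omega)) (fun h => hab1 h.symm) (hfar (by omega))
        (fun h => hfar (by omega) h.symm) (fun h => hfar (by omega) h.symm) hn (hfar (by omega))
        (hfar (by omega))
    obtain ⟨e, hae, he⟩ := hpred _ a' ha'
    obtain ⟨g, hbg, hg⟩ := hpred _ b' hb'
    have h1 : ¬ X.graph.Adj b' e := fun h => hnet e he hae h
    have h2 : ¬ X.graph.Adj a' g := fun h => hnet g hg h hbg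
    exact hX.not_c4 hadj' hbg (ih (n + 1) (by omega) g e hg he fun h => h1 (h ▸ hbg)) hae.symm h2 h1
      (hne (by omega)) (hne (by omega))
  exact fun u v huv hne => key _ u v rfl huv.symm hne

/-! ### Completions along a straight ordering. -/

/-- The closed neighbourhood. -/
def closedNbhd (G : SimpleGraph V) (u : V) : Set V := {w | w = u ∨ G.Adj u w}

/-- Classes of equal closed neighbourhoods are intervals of the ordering: a neighbour of `w` to the
left of `u` is adjacent to `u`, one to the right of `v` is adjacent to `v`, and everything between
`u` and `v` is adjacent to both, since `u` and `v` are themselves adjacent. -/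
theorem IsStraight.closedNbhd_eq_of_between [LinearOrder V] {G : SimpleGraph V}
    (hG : IsStraight G) {u v w : V} (huw : u < w) (hwv : w < v)
    (h : closedNbhd G u = closedNbhd G v) : closedNbhd G w = closedNbhd G u := by
  have hiff : ∀ x, (x = u ∨ G.Adj u x) ↔ (x = v ∨ G.Adj v x) := fun x => Set.ext_iff.1 h x
  have huv : G.Adj u v := ((hiff v).2 (Or.inl rfl)).resolve_left (huw.trans hwv).ne'
  obtain ⟨h1, h2⟩ := hG _ _ _ huw hwv huv
  ext x
  constructor
  · rintro (rfl | hx)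
    · exact Or.inr h1
    · rcases lt_trichotomy x w with hxw | rfl | hxw
      · rcases lt_trichotomy x u with hxu | rfl | hxu
        · exact Or.inr (hG _ _ _ hxu huw hx.symm).1.symm
        · exact Or.inl rfl
        · exact Or.inr (hG _ _ _ hxu hxw h1).1
      · exact Or.inr h1
      · rcases lt_trichotomy x v with hxv | rfl | hxv
        · exact Or.inr (hG _ _ _ (huw.trans hxw) hxv huv).1
        · exact Or.inr huv
        · exact (hiff x).2 (Or.inr (hG _ _ _ hwv hxv hx).2)
  · intro hx
    have hx1 : x = u ∨ G.Adj u x := hx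
    have hx2 := (hiff x).1 hx1
    rcases lt_trichotomy x w with hxw | rfl | hxw
    · rcases hx2 with rfl | hx2
      · exact absurd hxw hwv.asymm
      · exact Or.inr (hG _ _ _ hxw hwv hx2.symm).1.symm
    · exact Or.inl rfl
    · rcases hx1 with rfl | hx1
      · exact absurd hxw huw.asymm
      · exact Or.inr (hG _ _ _ huw hxw hx1).2

/-- If all arcs between vertices with different closed neighbourhoods follow a straight ordering and
the other arcs form no directed cycle, then there is a completion. -/
theorem completable_of_isStraight [LinearOrder V] {X : PartiallyOrientedGraph V}
    (hG : IsStraight X.graph)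
    (hfw : ∀ u v, X.arc u v → closedNbhd X.graph u ≠ closedNbhd X.graph v → u < v)
    (hac : ∀ v, ¬ Relation.TransGen
      (fun a b => X.arc a b ∧ closedNbhd X.graph a = closedNbhd X.graph b) v v) :
    X.Completable := by
  set r : V → V → Prop := fun a b => X.arc a b ∧ closedNbhd X.graph a = closedNbhd X.graph b
  -- Without directed cycles the arcs inside the classes generate a partial order. A linear
  -- extension `s` of it replaces the given ordering inside each class.
  have hpo : IsPartialOrder V (Relation.ReflTransGen r) :=
    { refl := fun _ => .refl
      trans := fun _ _ _ h h' => h.trans h'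
      antisymm := fun a b h h' => by
        rcases Relation.reflTransGen_iff_eq_or_transGen.1 h with h1 | h1
        · exact h1.symm
        · exact absurd (h1.trans_left h') (hac a) }
  obtain ⟨s, hs, hrs⟩ := extend_partialOrder (Relation.ReflTransGen r)
  let N := closedNbhd X.graph
  let lt : V → V → Prop := fun u v => (N u ≠ N v ∧ u < v) ∨ (N u = N v ∧ s u v ∧ u ≠ v)
  have hbt : ∀ {u v w}, u < w → w < v → N u = N v → N w = N u := fun h h' h'' =>
    hG.closedNbhd_eq_of_between h h' h''
  have hirr : ∀ u, ¬ lt u u := by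
    rintro u (h | h)
    · exact h.1 rfl
    · exact h.2.2 rfl
  -- In the mixed cases transitivity relies on the classes being intervals.
  have htrans : ∀ {u v w}, lt u v → lt v w → lt u w := by
    rintro u v w (⟨h1, h2⟩ | ⟨h1, h2, h2'⟩) (⟨h3, h4⟩ | ⟨h3, h4, h4'⟩)
    · exact Or.inl ⟨fun h => h1 (hbt h2 h4 h).symm, h2.trans h4⟩
    · refine Or.inl ⟨fun h => h1 (h.trans h3.symm), lt_of_not_ge fun hle => ?_⟩
      rcases hle.lt_or_eq with hlt | rfl
      · exact h1 ((hbt hlt h2 h3.symm).trans h3.symm)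
      · exact h1 h3.symm
    · refine Or.inl ⟨fun h => h3 (h1.symm.trans h), lt_of_not_ge fun hle => ?_⟩
      rcases hle.lt_or_eq with hlt | rfl
      · exact h3 (hbt h4 hlt h1.symm).symm
      · exact h3 h1.symm
    · refine Or.inr ⟨h1.trans h3, _root_.trans h2 h4, ?_⟩
      rintro rfl
      exact h2' (antisymm h2 h4)
  have htot : ∀ u v, u ≠ v → lt u v ∨ lt v u := by
    intro u v huv
    by_cases h : N u = N v
    · rcases total_of s u v with h' | h'
      · exact Or.inl (Or.inr ⟨h, h', huv⟩)
      · exact Or.inr (Or.inr ⟨h.symm, h', huv.symm⟩)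
    · rcases lt_or_gt_of_ne huv with h' | h'
      · exact Or.inl (Or.inl ⟨h, h'⟩)
      · exact Or.inr (Or.inl ⟨fun h'' => h h''.symm, h'⟩)
  have htw : ∀ {u v}, N u = N v → u ≠ v → X.graph.Adj u v := by
    intro u v h huv
    have : v ∈ N u := by
      rw [h]
      exact Or.inl rfl
    exact this.resolve_left huv.symm
  -- The modified ordering is still straight: vertices of one class have the same neighbours, and
  -- across classes the old ordering decides. Orienting along it gives the completion.
  have hst : ∀ {u v w}, lt u v → lt v w → X.graph.Adj u w → X.graph.Adj u v ∧ X.graph.Adj v w := by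
    intro u v w huv hvw huw
    by_cases h1 : N u = N v
    · refine ⟨htw h1 fun h => hirr u (by rw [← h] at huv; exact huv), ?_⟩
      have : w ∈ N v := by
        rw [← h1]
        exact Or.inr huw
      exact this.resolve_left fun h => hirr v (by rw [h] at hvw; exact hvw)
    by_cases h2 : N v = N w
    · refine ⟨?_, htw h2 fun h => hirr v (by rw [← h] at hvw; exact hvw)⟩
      have : u ∈ N v := by
        rw [h2]
        exact Or.inr huw.symm
      exact (this.resolve_left fun h => hirr u (by rw [← h] at huv; exact huv)).symm
    · exact hG u v w (huv.resolve_right fun h => h1 h.1).2 (hvw.resolve_right fun h => h2 h.1).2 huw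
  have hor : ∀ u v, X.graph.Adj u v →
      (X.graph.Adj u v ∧ lt u v) ∨ (X.graph.Adj v u ∧ lt v u) := fun u v huv =>
    (htot u v huv.ne).imp (fun h => ⟨huv, h⟩) fun h => ⟨huv.symm, h⟩
  refine ⟨⟨X.graph, fun u v => X.graph.Adj u v ∧ lt u v, fun _ _ h => h.1,
    fun u v h h' => hirr u (htrans h.2 h'.2)⟩, ⟨rfl, ?_, hor⟩, ⟨hor, ?_⟩, ?_⟩
  · intro u v huv
    refine ⟨X.arc_adj _ _ huv, ?_⟩
    by_cases h : N u = N v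
    · exact Or.inr ⟨h, hrs _ _ (.single ⟨huv, h⟩), (X.arc_adj _ _ huv).ne⟩
    · exact Or.inl ⟨h, hfw _ _ huv h⟩
  · intro v
    constructor
    · rintro a ⟨ha, ha'⟩ b ⟨hb, hb'⟩ hab
      refine hor a b ?_
      rcases htot a b hab with h | h
      · exact (hst h hb' ha).1
      · exact (hst h ha' hb).1.symm
    · rintro a ⟨ha, ha'⟩ b ⟨hb, hb'⟩ hab
      refine hor a b ?_
      rcases htot a b hab with h | h
      · exact (hst ha' h hb).2
      · exact (hst hb' h ha).2.symm
  · intro v hv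
    have : ∀ w, Relation.TransGen (fun u v => X.graph.Adj u v ∧ lt u v) v w → lt v w := by
      intro w hw
      induction hw with
      | single h => exact h.2
      | tail _ h ih => exact htrans ih h.2
    exact hirr v (this v hv)

/-- A directed cycle inside a clique yields one of the graphs `cyclicClique`. -/
theorem contains_cyclicClique {X : PartiallyOrientedGraph V} {r : V → V → Prop}
    (hr : ∀ u v, r u v → X.arc u v)
    (hcl : ∀ u v, Relation.TransGen r u v → u ≠ v → X.graph.Adj u v) {v : V}
    (hv : Relation.TransGen r v v) :
    ∃ (k : ℕ) (hk : 3 ≤ k), X.Contains (cyclicClique k hk) := by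
  classical
  have hseq : ∀ a b, Relation.TransGen r a b → ∃ (n : ℕ) (p : ℕ → V), p 0 = a ∧ p (n + 1) = b ∧
      ∀ i ≤ n, r (p i) (p (i + 1)) := by
    intro a b hab
    induction hab with
    | @single b h =>
      exact ⟨0, fun i => if i = 0 then a else b, by simp, by simp, fun i hi => by
        obtain rfl : i = 0 := by omega
        simpa using h⟩
    | @tail b c _ hbc ih =>
      obtain ⟨n, p, h0, hn, hp⟩ := ih
      refine ⟨n + 1, fun i => if i ≤ n + 1 then p i else c, by simp [h0], by simp, ?_⟩
      intro i hi
      beta_reduce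
      rcases Nat.lt_or_ge i (n + 1) with h | h
      · rw [if_pos (by omega), if_pos (by omega)]
        exact hp i (by omega)
      · obtain rfl : i = n + 1 := by omega
        simpa [hn] using hbc
  let P : ℕ → Prop := fun n => ∃ p : ℕ → V, p (n + 1) = p 0 ∧ ∀ i ≤ n, r (p i) (p (i + 1))
  have hP : ∃ n, P n := by
    obtain ⟨n, p, h0, hn, hp⟩ := hseq v v hv
    exact ⟨n, p, hn.trans h0.symm, hp⟩
  -- A shortest closed walk of `r` has no repeated vertex. Its length `n + 1` is at least three
  -- because arcs are irreflexive and asymmetric.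
  obtain ⟨p, hclose, hp⟩ := Nat.find_spec hP
  have hmin : ∀ k, P k → Nat.find hP ≤ k := fun k hk => Nat.find_min' hP hk
  generalize Nat.find hP = n at *
  have hinj : ∀ i j, i < j → j ≤ n → p i ≠ p j := by
    intro i j hij hj he
    have := hmin (j - i - 1) ⟨fun k => p (i + k), ?_, fun k hk => hp (i + k) (by omega)⟩
    · omega
    · change p (i + (j - i - 1 + 1)) = p i
      rw [show i + (j - i - 1 + 1) = j by omega, he]
  have hpath : ∀ i j, i < j → j ≤ n → Relation.TransGen r (p i) (p j) := by
    intro i j hij hj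
    have := transGen_of_steps (a := r) (fun k => p (i + k)) (j - i - 1)
      fun k hk => hp (i + k) (by omega)
    have he : i + (j - i - 1 + 1) = j := by omega
    simpa [he] using this
  have hn : 2 ≤ n := by
    by_contra hlt
    rcases (show n = 0 ∨ n = 1 by omega) with rfl | rfl
    · have := hp 0 le_rfl
      rw [hclose] at this
      exact (X.arc_adj _ _ (hr _ _ this)).ne rfl
    · have h0 := hp 0 (by omega)
      have h1 := hp 1 le_rfl
      rw [hclose] at h1
      exact X.arc_asymm _ _ (hr _ _ h0) (hr _ _ h1)
  refine ⟨n + 1, by omega, contains_of_lt (fun i => p i.val) ?_ ?_⟩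
  · intro a b hab
    have hab' : a.val < b.val := hab
    have hne := hinj a.val b.val hab' (by omega)
    exact ⟨hne, iff_of_true hab.ne (hcl _ _ (hpath _ _ hab' (by omega)) hne)⟩
  · rintro a b (h | ⟨h, h'⟩)
    · rw [← h]
      exact hr _ _ (hp _ (by omega))
    · have := hp a.val (by omega)
      rw [h, hclose] at this
      rw [h']
      exact hr _ _ this

/-! ### Small straight-ordered configurations

A connected straight-ordered graph on `0, …, n - 1` is given by the list `ρ` whose entry at `a` is
the last vertex that is equal or adjacent to `a`. -/

/-- Adjacency in the straight-ordered graph given by `ρ`. -/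
def reachAdj (ρ : List ℕ) (a b : ℕ) : Bool :=
  if a < b then Nat.ble b (ρ.getD a 0) else (Nat.blt b a && Nat.ble a (ρ.getD b 0))

/-- Some vertex below `n` other than `v` is adjacent to exactly one of `i` and `j`. -/
def reachSep (ρ : List ℕ) (n i j v : ℕ) : Bool :=
  (List.range n).any fun t => !(t == i) && !(t == j) && !(t == v) &&
    (reachAdj ρ i t != reachAdj ρ j t)

/-- The list `ρ`, the positions `i, j, k, l` of the arcs `i → j` and `l → k`, and the positions of
the vertices of the graph that is found. -/
abbrev Row : Type := List ℕ × (ℕ × ℕ × ℕ × ℕ) × List ℕ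

/-- The tables group configurations by the graph they contain, possibly after dualising. Since at
most six vertices are present, only the smallest members of two path families occur, and the family
with two triangles not at all. -/
def diamondDisjointRows : List Row := [
  ([2, 3, 3, 3], (0, 1, 2, 3), [0, 1, 2, 3]),
  ([2, 3, 3, 3], (0, 2, 1, 3), [0, 2, 1, 3]),
  ([2, 3, 3, 3], (1, 3, 0, 2), [0, 2, 1, 3]),
  ([2, 3, 3, 3], (2, 3, 0, 1), [0, 1, 2, 3])]

def diamondSharedRows : List Row := [
  ([2, 3, 3, 3], (0, 1, 0, 2), [0, 1, 2, 3]),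
  ([2, 3, 3, 3], (0, 2, 0, 1), [0, 2, 1, 3]),
  ([2, 3, 3, 3], (1, 3, 2, 3), [3, 2, 1, 0]),
  ([2, 3, 3, 3], (2, 3, 1, 3), [3, 1, 2, 0])]

def gemSharedRows : List Row := [
  ([2, 3, 4, 4, 4], (0, 1, 1, 2), [0, 1, 2, 3, 4]),
  ([2, 3, 4, 4, 4], (1, 2, 0, 1), [0, 1, 2, 3, 4]),
  ([2, 3, 4, 4, 4], (2, 3, 3, 4), [4, 3, 2, 1, 0]),
  ([2, 3, 4, 4, 4], (3, 4, 2, 3), [4, 3, 2, 1, 0])]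

def gemDisjointRows : List Row := [
  ([2, 3, 4, 4, 4], (0, 1, 2, 4), [0, 1, 2, 3, 4]),
  ([2, 3, 4, 4, 4], (0, 2, 3, 4), [4, 3, 2, 1, 0]),
  ([2, 3, 4, 4, 4], (2, 4, 0, 1), [0, 1, 2, 3, 4]),
  ([2, 3, 4, 4, 4], (3, 4, 0, 2), [4, 3, 2, 1, 0])]

def fiveVertexRows : List Row := [
  ([2, 4, 4, 4, 4], (1, 3, 2, 4), [4, 3, 2, 1, 0]),
  ([2, 4, 4, 4, 4], (1, 4, 2, 3), [3, 4, 2, 1, 0]),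
  ([2, 4, 4, 4, 4], (2, 3, 1, 4), [4, 3, 1, 2, 0]),
  ([2, 4, 4, 4, 4], (2, 4, 1, 3), [3, 4, 1, 2, 0]),
  ([3, 3, 4, 4, 4], (0, 2, 1, 3), [0, 1, 2, 3, 4]),
  ([3, 3, 4, 4, 4], (0, 3, 1, 2), [0, 1, 3, 2, 4]),
  ([3, 3, 4, 4, 4], (1, 2, 0, 3), [1, 0, 2, 3, 4]),
  ([3, 3, 4, 4, 4], (1, 3, 0, 2), [1, 0, 3, 2, 4])]

def sixVertexARows : List Row := [
  ([2, 4, 5, 5, 5, 5], (2, 3, 4, 5), [5, 4, 3, 2, 1, 0]),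
  ([2, 4, 5, 5, 5, 5], (2, 4, 3, 5), [5, 3, 4, 2, 1, 0]),
  ([2, 4, 5, 5, 5, 5], (3, 5, 2, 4), [5, 3, 4, 2, 1, 0]),
  ([2, 4, 5, 5, 5, 5], (4, 5, 2, 3), [5, 4, 3, 2, 1, 0]),
  ([3, 4, 4, 5, 5, 5], (0, 1, 2, 3), [0, 1, 2, 3, 4, 5]),
  ([3, 4, 4, 5, 5, 5], (0, 2, 1, 3), [0, 2, 1, 3, 4, 5]),
  ([3, 4, 4, 5, 5, 5], (1, 3, 0, 2), [0, 2, 1, 3, 4, 5]),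
  ([3, 4, 4, 5, 5, 5], (2, 3, 0, 1), [0, 1, 2, 3, 4, 5])]

def sixVertexBRows : List Row := [
  ([3, 4, 5, 5, 5, 5], (1, 2, 3, 4), [0, 1, 2, 3, 4, 5]),
  ([3, 4, 5, 5, 5, 5], (1, 3, 2, 4), [0, 1, 3, 2, 4, 5]),
  ([3, 4, 5, 5, 5, 5], (2, 4, 1, 3), [0, 1, 3, 2, 4, 5]),
  ([3, 4, 5, 5, 5, 5], (3, 4, 1, 2), [0, 1, 2, 3, 4, 5])]

def pawArcsRows : List Row := [
  ([1, 3, 3, 3], (1, 2, 1, 3), [0, 1, 2, 3]),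
  ([1, 3, 3, 3], (1, 3, 1, 2), [0, 1, 3, 2]),
  ([2, 2, 3, 3], (0, 2, 1, 2), [3, 2, 1, 0]),
  ([2, 2, 3, 3], (1, 2, 0, 2), [3, 2, 0, 1])]

def bullArcsRows : List Row := [
  ([1, 3, 3, 4, 4], (1, 2, 2, 3), [0, 1, 2, 3, 4]),
  ([1, 3, 3, 4, 4], (2, 3, 1, 2), [0, 1, 2, 3, 4])]

def gemCentralRows : List Row := [
  ([2, 3, 4, 4, 4], (1, 2, 2, 3), [0, 1, 2, 3, 4]),
  ([2, 3, 4, 4, 4], (2, 3, 1, 2), [0, 1, 2, 3, 4])]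

def cliquePendantsRows : List Row := [
  ([1, 4, 4, 4, 5, 5], (1, 2, 3, 4), [0, 1, 2, 3, 4, 5]),
  ([1, 4, 4, 4, 5, 5], (1, 3, 2, 4), [0, 1, 3, 2, 4, 5]),
  ([1, 4, 4, 4, 5, 5], (2, 4, 1, 3), [0, 1, 3, 2, 4, 5]),
  ([1, 4, 4, 4, 5, 5], (3, 4, 1, 2), [0, 1, 2, 3, 4, 5])]

def pathSquareRows : List Row := [
  ([2, 3, 4, 5, 5, 5], (0, 1, 4, 5), [0, 1, 2, 3, 4, 5]),
  ([2, 3, 4, 5, 5, 5], (4, 5, 0, 1), [0, 1, 2, 3, 4, 5])]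

def pathArcs0Rows : List Row := [
  ([1, 2, 2], (0, 1, 1, 2), [0, 1, 2]),
  ([1, 2, 2], (1, 2, 0, 1), [0, 1, 2])]

def pathArcs1Rows : List Row := [
  ([1, 2, 3, 3], (0, 1, 2, 3), [0, 1, 2, 3]),
  ([1, 2, 3, 3], (2, 3, 0, 1), [0, 1, 2, 3])]

def pathArcs2Rows : List Row := [
  ([1, 2, 3, 4, 4], (0, 1, 3, 4), [0, 1, 2, 3, 4]),
  ([1, 2, 3, 4, 4], (3, 4, 0, 1), [0, 1, 2, 3, 4])]

def pathArcs3Rows : List Row := [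
  ([1, 2, 3, 4, 5, 5], (0, 1, 4, 5), [0, 1, 2, 3, 4, 5]),
  ([1, 2, 3, 4, 5, 5], (4, 5, 0, 1), [0, 1, 2, 3, 4, 5])]

def pathOneTriangle0Rows : List Row := [
  ([1, 3, 3, 4, 4], (0, 1, 2, 3), [4, 3, 2, 1, 0]),
  ([1, 3, 3, 4, 4], (1, 2, 3, 4), [0, 1, 2, 3, 4]),
  ([1, 3, 3, 4, 4], (2, 3, 0, 1), [4, 3, 2, 1, 0]),
  ([1, 3, 3, 4, 4], (3, 4, 1, 2), [0, 1, 2, 3, 4])]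

def pathOneTriangle1Rows : List Row := [
  ([1, 2, 4, 4, 5, 5], (0, 1, 3, 4), [5, 4, 3, 2, 1, 0]),
  ([1, 2, 4, 4, 5, 5], (3, 4, 0, 1), [5, 4, 3, 2, 1, 0]),
  ([1, 3, 3, 4, 5, 5], (1, 2, 4, 5), [0, 1, 2, 3, 4, 5]),
  ([1, 3, 3, 4, 5, 5], (4, 5, 1, 2), [0, 1, 2, 3, 4, 5])]

def tableRows : List Row :=
  diamondDisjointRows ++ diamondSharedRows ++ gemSharedRows ++ gemDisjointRows ++
  fiveVertexRows ++ sixVertexARows ++ sixVertexBRows ++ pawArcsRows ++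
  bullArcsRows ++ gemCentralRows ++ cliquePendantsRows ++ pathSquareRows ++
  pathArcs0Rows ++ pathArcs1Rows ++ pathArcs2Rows ++ pathArcs3Rows ++
  pathOneTriangle0Rows ++ pathOneTriangle1Rows

/-- Every configuration on `n` vertices with arcs `i → j` and `l → k` in opposite directions stays
one after the deletion of some vertex, or it occurs in the table. -/
def reachCheck (n : ℕ) (ρ : List ℕ) : Bool :=
  (List.range n).all fun i => (List.range n).all fun j =>
    -- The last argument `n` of `reachSep` is not a vertex, so no witness is excluded.
    !(Nat.blt i j && reachAdj ρ i j && reachSep ρ n i j n) ||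
    (List.range n).all fun k => (List.range n).all fun l =>
      !(Nat.blt k l && reachAdj ρ k l && reachSep ρ n k l n && !(i == k && j == l)) ||
      ((List.range n).any fun v => !(v == i) && !(v == j) && !(v == k) && !(v == l) &&
        -- Deleting `v` keeps consecutive vertices adjacent if `v` is an end of the chain or its two
        -- neighbours in the chain are adjacent.
        (v == 0 || v + 1 == n || reachAdj ρ (v - 1) (v + 1)) &&
        reachSep ρ n i j v && reachSep ρ n k l v) ||
      tableRows.any fun row => row.1 == ρ && row.2.1 == (i, j, k, l)

/-- The possible lists `ρ` for a connected graph, in the form of their last `m` entries. -/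
def reachLists (n : ℕ) : ℕ → List (List ℕ)
  | 0 => [[]]
  | m + 1 => (reachLists n m).flatMap fun ρ =>
    -- The entry being prepended belongs to vertex `n - (m + 1)`. It must reach further than that
    -- vertex, except for the last one (`m = 0`), and not beyond the next entry; the default `r`
    -- makes this second condition void when there is no next entry.
    ((List.range n).filter fun r => (m == 0 || Nat.blt (n - (m + 1)) r) &&
      Nat.ble r (ρ.getD 0 r)).map fun r => r :: ρ

theorem reachCheck_of_mem : ∀ n ≤ 6, ∀ ρ ∈ reachLists n n, reachCheck n ρ = true := by
  decide +kernel

/-- Consecutive adjacency gives `a < ρ a` and straightness gives monotonicity; these conditions on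
`ρ` are all that the enumeration imposes. -/
theorem mem_reachLists (n : ℕ) (ρ : ℕ → ℕ) (hlt : ∀ a < n, ρ a < n)
    (hsucc : ∀ a, a + 1 < n → a < ρ a) (hmono : ∀ a, a + 1 < n → ρ a ≤ ρ (a + 1)) :
    ∀ m ≤ n, (List.range' (n - m) m).map ρ ∈ reachLists n m := by
  intro m
  induction m with
  | zero => simp [reachLists]
  | succ m ih =>
    intro hm
    rw [reachLists, List.mem_flatMap]
    refine ⟨_, ih (by omega), ?_⟩
    rw [List.mem_map]
    refine ⟨ρ (n - (m + 1)), ?_, ?_⟩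
    · rw [List.mem_filter, List.mem_range]
      refine ⟨hlt _ (by omega), ?_⟩
      rcases m with _ | m
      · simp
      · have h1 := hsucc (n - (m + 1 + 1)) (by omega)
        have h2 := hmono (n - (m + 1 + 1)) (by omega)
        rw [show n - (m + 1 + 1) + 1 = n - (m + 1) by omega] at h2
        simp only [Bool.and_eq_true, Bool.or_eq_true, Nat.blt_eq, Nat.ble_eq]
        refine ⟨Or.inr h1, ?_⟩
        simpa [List.range'_succ] using h2
    · rw [List.range'_succ, List.map_cons, show n - (m + 1) + 1 = n - m by omega]

/-- A chain of vertices carrying two unbalanced arcs in opposite directions. -/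
structure IsConfig [LinearOrder V] (X : PartiallyOrientedGraph V) (n : ℕ) (e : ℕ → V)
    (i j k l : ℕ) : Prop where
  mono : ∀ a b, a < b → b < n → e a < e b
  conn : ∀ a, a + 1 < n → X.graph.Adj (e a) (e (a + 1))
  lt : i < j
  lt' : k < l
  lt_n : j < n
  lt_n' : l < n
  arc : X.arc (e i) (e j)
  arc' : X.arc (e l) (e k)
  sep : ∃ t < n, t ≠ i ∧ t ≠ j ∧ ¬ (X.graph.Adj (e i) (e t) ↔ X.graph.Adj (e j) (e t))
  sep' : ∃ t < n, t ≠ k ∧ t ≠ l ∧ ¬ (X.graph.Adj (e k) (e t) ↔ X.graph.Adj (e l) (e t))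

/-- The row describes an embedding of `Y` or its dual. -/
def RowFits {m : ℕ} (Y : PartiallyOrientedGraph (Fin m)) (row : Row) : Prop :=
  (∀ a b : Fin m, a < b → row.2.2.getD a 0 ≠ row.2.2.getD b 0 ∧
    (Y.graph.Adj a b ↔ reachAdj row.1 (row.2.2.getD a 0) (row.2.2.getD b 0) = true)) ∧
  (∀ a : Fin m, row.2.2.getD a 0 < row.1.length) ∧
  -- The entries of `row.2.1` are `i, j, k, l`, so each arc of `Y` must land on `i → j` or on `l →
  -- k`; in the second alternative the same holds for the reversed arcs.
  ((∀ a b : Fin m, Y.arc a b →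
      (row.2.2.getD a 0 = row.2.1.1 ∧ row.2.2.getD b 0 = row.2.1.2.1) ∨
      (row.2.2.getD a 0 = row.2.1.2.2.2 ∧ row.2.2.getD b 0 = row.2.1.2.2.1)) ∨
    (∀ a b : Fin m, Y.arc a b →
      (row.2.2.getD b 0 = row.2.1.1 ∧ row.2.2.getD a 0 = row.2.1.2.1) ∨
      (row.2.2.getD b 0 = row.2.1.2.2.2 ∧ row.2.2.getD a 0 = row.2.1.2.2.1)))

instance {m : ℕ} (Y : PartiallyOrientedGraph (Fin m)) [DecidableRel Y.graph.Adj]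
    [DecidableRel Y.arc] (row : Row) : Decidable (RowFits Y row) := by
  unfold RowFits
  infer_instance

instance (m : ℕ) : DecidableRel (pathArcs m).graph.Adj := fun u v =>
  decidable_of_iff (u.val + 1 = v.val ∨ v.val + 1 = u.val) SimpleGraph.pathGraph_adj.symm

instance (m : ℕ) : DecidableRel (pathArcs m).arc := fun i j =>
  inferInstanceAs (Decidable ((i.val = 0 ∧ j.val = 1) ∨ (i.val = m + 2 ∧ j.val = m + 1)))

theorem pathOneTriangle_adj {m : ℕ} {u v : Fin (m + 5)} : (pathOneTriangle m).graph.Adj u v ↔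
    u.val + 1 = v.val ∨ v.val + 1 = u.val ∨ (u.val = 1 ∧ v.val = 3) ∨
      (u.val = 3 ∧ v.val = 1) := by
  simp only [pathOneTriangle, SimpleGraph.sup_adj, SimpleGraph.pathGraph_adj,
    SimpleGraph.fromRel_adj, ne_eq, Fin.ext_iff]
  omega

instance (m : ℕ) : DecidableRel (pathOneTriangle m).graph.Adj := fun _ _ =>
  decidable_of_iff _ pathOneTriangle_adj.symm

instance (m : ℕ) : DecidableRel (pathOneTriangle m).arc := fun i j =>
  inferInstanceAs (Decidable ((i.val = 1 ∧ j.val = 2) ∨ (i.val = m + 4 ∧ j.val = m + 3)))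

theorem RowFits.contains [LinearOrder V] {X : PartiallyOrientedGraph V} {n : ℕ} {e : ℕ → V}
    {i j k l : ℕ} (he : IsConfig X n e i j k l) {ρ σ : List ℕ} (hlen : ρ.length = n)
    (hρ : ∀ a b, a < n → b < n → (X.graph.Adj (e a) (e b) ↔ reachAdj ρ a b = true))
    {m : ℕ} {Y : PartiallyOrientedGraph (Fin m)} (hrow : RowFits Y (ρ, (i, j, k, l), σ)) :
    X.Contains Y ∨ X.dual.Contains Y := by
  obtain ⟨h1, h2, h3⟩ := hrow
  have hinj : ∀ a b, a < n → b < n → a ≠ b → e a ≠ e b := by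
    intro a b ha hb hab
    rcases lt_or_gt_of_ne hab with h | h
    · exact (he.mono _ _ h hb).ne
    · exact (he.mono _ _ h ha).ne'
  have key : ∀ a b : Fin m, a < b → e (σ.getD a 0) ≠ e (σ.getD b 0) ∧
      (Y.graph.Adj a b ↔ X.graph.Adj (e (σ.getD a 0)) (e (σ.getD b 0))) := by
    intro a b hab
    obtain ⟨h4, h5⟩ := h1 a b hab
    have ha := h2 a
    have hb := h2 b
    dsimp only at h4 h5 ha hb
    rw [hlen] at ha hb
    exact ⟨hinj _ _ ha hb h4, h5.trans (hρ _ _ ha hb).symm⟩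
  refine h3.imp (fun h3 => ?_) (fun h3 => ?_)
  · refine contains_of_lt (fun a : Fin m => e (σ.getD a 0)) key fun a b hab => ?_
    rcases h3 a b hab with ⟨ha, hb⟩ | ⟨ha, hb⟩ <;> dsimp only at ha hb <;> rw [ha, hb]
    · exact he.arc
    · exact he.arc'
  · refine contains_of_lt (fun a : Fin m => e (σ.getD a 0)) key fun a b hab => ?_
    rcases h3 a b hab with ⟨ha, hb⟩ | ⟨ha, hb⟩ <;> dsimp only at ha hb <;> rw [ha, hb]
    · exact he.arc
    · exact he.arc'

theorem IsObstruction.isListed_of_contains {X : PartiallyOrientedGraph V} (hX : X.IsObstruction)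
    {Y : PartiallyOrientedGraph W} (hY : ¬ Y.Completable)
    (hL : ∀ X' : PartiallyOrientedGraph V, X'.Isomorphic Y → X'.IsListed)
    (h : X.Contains Y ∨ X.dual.Contains Y) : X.IsListed ∨ X.dual.IsListed :=
  h.imp (fun h => hL _ (hX.isomorphic_of_contains h hY))
    fun h => hL _ (hX.dual.isomorphic_of_contains h hY)

/-- Every row of the table leads to a listed graph. -/
theorem isListed_of_mem_tableRows [LinearOrder V] {X : PartiallyOrientedGraph V}
    (hX : X.IsObstruction) {n : ℕ} {e : ℕ → V} {i j k l : ℕ} (he : IsConfig X n e i j k l)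
    {ρ σ : List ℕ} (hlen : ρ.length = n)
    (hρ : ∀ a b, a < n → b < n → (X.graph.Adj (e a) (e b) ↔ reachAdj ρ a b = true))
    (hmem : (ρ, (i, j, k, l), σ) ∈ tableRows) : X.IsListed ∨ X.dual.IsListed := by
  have key : ∀ {m : ℕ} (Y : PartiallyOrientedGraph (Fin m)) (_ : ¬ Y.Completable)
      (_ : ∀ X' : PartiallyOrientedGraph V, X'.Isomorphic Y → X'.IsListed) (rows : List Row)
      (_ : ∀ row ∈ rows, RowFits Y row), (ρ, (i, j, k, l), σ) ∈ rows →
      X.IsListed ∨ X.dual.IsListed := fun Y hY hL rows hrows hm =>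
    hX.isListed_of_contains hY hL (RowFits.contains he hlen hρ (hrows _ hm))
  have loc : ∀ {X' : PartiallyOrientedGraph V}, X'.IsListedLocallyCompletable → X'.IsListed :=
    fun h => Or.inr (Or.inr (Or.inl h))
  have nloc : ∀ {X' : PartiallyOrientedGraph V}, X'.IsListedNotLocallyCompletable → X'.IsListed :=
    fun h => Or.inr (Or.inr (Or.inr h))
  have hpath : ∀ m, ∀ X' : PartiallyOrientedGraph V, X'.Isomorphic (pathArcs m) → X'.IsListed :=
    fun m X' h => nloc (by
      unfold IsListedNotLocallyCompletable
      exact Or.inr (Or.inr (Or.inr (Or.inr (Or.inr (Or.inl ⟨m, h⟩))))))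
  have htri : ∀ m, ∀ X' : PartiallyOrientedGraph V, X'.Isomorphic (pathOneTriangle m) →
      X'.IsListed := fun m X' h => nloc (by
      unfold IsListedNotLocallyCompletable
      exact Or.inr (Or.inr (Or.inr (Or.inr (Or.inl ⟨m, h⟩)))))
  simp only [tableRows, List.mem_append, or_assoc] at hmem
  rcases hmem with h | h | h | h | h | h | h | h | h | h | h | h | h | h | h | h | h | h
  · exact key _ diamondDisjoint_not_completable
      (fun X' h => loc (by unfold IsListedLocallyCompletable; tauto)) _
      (by unfold diamondDisjoint; decide +kernel) h
  · exact key _ diamondShared_not_completable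
      (fun X' h => loc (by unfold IsListedLocallyCompletable; tauto)) _
      (by unfold diamondShared; decide +kernel) h
  · exact key _ gemShared_not_completable
      (fun X' h => loc (by unfold IsListedLocallyCompletable; tauto)) _
      (by unfold gemShared; decide +kernel) h
  · exact key _ gemDisjoint_not_completable
      (fun X' h => loc (by unfold IsListedLocallyCompletable; tauto)) _
      (by unfold gemDisjoint; decide +kernel) h
  · exact key _ fiveVertex_not_completable
      (fun X' h => loc (by unfold IsListedLocallyCompletable; tauto)) _
      (by unfold fiveVertex; decide +kernel) h
  · exact key _ sixVertexA_not_completable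
      (fun X' h => loc (by unfold IsListedLocallyCompletable; tauto)) _
      (by unfold sixVertexA; decide +kernel) h
  · exact key _ sixVertexB_not_completable
      (fun X' h => loc (by unfold IsListedLocallyCompletable; tauto)) _
      (by unfold sixVertexB; decide +kernel) h
  · exact key _ pawArcs_not_completable
      (fun X' h => nloc (by unfold IsListedNotLocallyCompletable; tauto)) _
      (by unfold pawArcs; decide +kernel) h
  · exact key _ bullArcs_not_completable
      (fun X' h => nloc (by unfold IsListedNotLocallyCompletable; tauto)) _
      (by unfold bullArcs; decide +kernel) h
  · exact key _ gemCentral_not_completable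
      (fun X' h => nloc (by unfold IsListedNotLocallyCompletable; tauto)) _
      (by unfold gemCentral; decide +kernel) h
  · exact key _ cliquePendants_not_completable
      (fun X' h => nloc (by unfold IsListedNotLocallyCompletable; tauto)) _
      (by unfold cliquePendants; decide +kernel) h
  · exact key _ pathSquare_not_completable
      (fun X' h => nloc (by unfold IsListedNotLocallyCompletable; tauto)) _
      (by unfold pathSquare; decide +kernel) h
  · exact key _ (pathArcs_not_completable 0) (hpath 0) _ (by decide +kernel) h
  · exact key _ (pathArcs_not_completable 1) (hpath 1) _ (by decide +kernel) h
  · exact key _ (pathArcs_not_completable 2) (hpath 2) _ (by decide +kernel) h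
  · exact key _ (pathArcs_not_completable 3) (hpath 3) _ (by decide +kernel) h
  · exact key _ (pathOneTriangle_not_completable 0) (htri 0) _ (by decide +kernel) h
  · exact key _ (pathOneTriangle_not_completable 1) (htri 1) _ (by decide +kernel) h

/-- An obstruction with a straight ordering and a small configuration is listed. -/
theorem isListed_of_isConfig [LinearOrder V] {X : PartiallyOrientedGraph V}
    (hX : X.IsObstruction) (hG : IsStraight X.graph) : ∀ n ≤ 6, ∀ (e : ℕ → V) (i j k l : ℕ),
    IsConfig X n e i j k l → X.IsListed ∨ X.dual.IsListed := by
  classical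
  intro n
  induction n using Nat.strong_induction_on with
  | _ n ih =>
  intro hn e i j k l he
  -- Here `r a` is the last vertex of the chain equal or adjacent to `e a`. By straightness these
  -- numbers determine all adjacencies in the chain.
  let A : ℕ → ℕ → Prop := fun a b => b = a ∨ (a < b ∧ X.graph.Adj (e a) (e b))
  let r : ℕ → ℕ := fun a => Nat.findGreatest (A a) (n - 1)
  have hn0 : 0 < n := lt_of_le_of_lt (Nat.zero_le _) he.lt_n
  have hrA : ∀ a < n, A a (r a) := fun a ha =>
    Nat.findGreatest_spec (P := A a) (m := a) (by omega) (Or.inl rfl)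
  have hrmax : ∀ a b, b < n → A a b → b ≤ r a := fun a b hb h =>
    Nat.le_findGreatest (by omega) h
  have hrlt : ∀ a < n, r a < n := fun a _ => by
    have := Nat.findGreatest_le (P := A a) (n - 1)
    change Nat.findGreatest (A a) (n - 1) < n
    omega
  have hdown : ∀ a b c, a < b → b ≤ c → c < n → X.graph.Adj (e a) (e c) →
      X.graph.Adj (e a) (e b) := by
    intro a b c hab hbc hc h
    rcases hbc.lt_or_eq with hbc | rfl
    · exact (hG _ _ _ (he.mono _ _ hab (by omega)) (he.mono _ _ hbc hc) h).1
    · exact h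
  have hadj : ∀ a b, a < b → b < n → (X.graph.Adj (e a) (e b) ↔ b ≤ r a) := by
    intro a b hab hb
    refine ⟨fun h => hrmax a b hb (Or.inr ⟨hab, h⟩), fun h => ?_⟩
    rcases hrA a (by omega) with h' | ⟨h', h''⟩
    · omega
    · exact hdown _ _ _ hab h (hrlt a (by omega)) h''
  have hsucc : ∀ a, a + 1 < n → a < r a := fun a ha =>
    hrmax a (a + 1) ha (Or.inr ⟨by omega, he.conn a ha⟩)
  have hmono : ∀ a, a + 1 < n → r a ≤ r (a + 1) := by
    intro a ha
    rcases Nat.lt_or_ge (a + 1) (r a) with h | h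
    · refine hrmax _ _ (hrlt a (by omega)) (Or.inr ⟨h, ?_⟩)
      have := hsucc a ha
      refine (hG _ _ _ (he.mono a (a + 1) (by omega) ha)
        (he.mono _ _ h (hrlt a (by omega))) ?_).2
      exact (hadj a (r a) (by omega) (hrlt a (by omega))).2 le_rfl
    · exact h.trans (hrmax _ _ ha (Or.inl rfl))
  set ρ : List ℕ := (List.range' 0 n).map r with hρdef
  have hmem : ρ ∈ reachLists n n := by
    have := mem_reachLists n r hrlt hsucc hmono n le_rfl
    rwa [Nat.sub_self] at this
  have hlen : ρ.length = n := by simp [hρdef]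
  have hget : ∀ a < n, ρ.getD a 0 = r a := by
    intro a ha
    simp [hρdef, List.getD, ha]
  have hρ : ∀ a b, a < n → b < n → (X.graph.Adj (e a) (e b) ↔ reachAdj ρ a b = true) := by
    intro a b ha hb
    unfold reachAdj
    split_ifs with h
    · rw [hget a ha, Nat.ble_eq, hadj a b h hb]
    · rw [hget b hb, Bool.and_eq_true, Nat.blt_eq, Nat.ble_eq]
      rcases (Nat.le_of_not_lt h).lt_or_eq with h' | rfl
      · rw [X.graph.adj_comm, hadj b a h' ha]
        simp [h']
      · simp
  have hsep : ∀ a b v, a < n → b < n → ((∃ t < n, t ≠ a ∧ t ≠ b ∧ t ≠ v ∧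
      ¬ (X.graph.Adj (e a) (e t) ↔ X.graph.Adj (e b) (e t))) ↔ reachSep ρ n a b v = true) := by
    intro a b v ha hb
    simp only [reachSep, List.any_eq_true, List.mem_range, Bool.and_eq_true, Bool.not_eq_true',
      beq_eq_false_iff_ne, bne_iff_ne, and_assoc]
    refine exists_congr fun t => and_congr_right fun ht => ?_
    have heq : reachAdj ρ a t = reachAdj ρ b t ↔
        (reachAdj ρ a t = true ↔ reachAdj ρ b t = true) := Bool.eq_iff_iff
    rw [hρ a t ha ht, hρ b t hb ht, ne_eq (reachAdj ρ a t) (reachAdj ρ b t), heq]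
  have hi : i < n := he.lt.trans he.lt_n
  have hk : k < n := he.lt'.trans he.lt_n'
  have hcheck := reachCheck_of_mem n hn ρ hmem
  simp only [reachCheck, List.all_eq_true, List.mem_range] at hcheck
  have h1 := hcheck i hi j he.lt_n
  have hij : (Nat.blt i j && reachAdj ρ i j && reachSep ρ n i j n) = true := by
    obtain ⟨t, ht, h1, h2, h3⟩ := he.sep
    rw [Bool.and_eq_true, Bool.and_eq_true, Nat.blt_eq, ← hρ i j hi he.lt_n,
      ← hsep i j n hi he.lt_n]
    exact ⟨⟨he.lt, X.arc_adj _ _ he.arc⟩, t, ht, h1, h2, ht.ne, h3⟩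
  have hkl : (Nat.blt k l && reachAdj ρ k l && reachSep ρ n k l n && !(i == k && j == l)) =
      true := by
    obtain ⟨t, ht, h1, h2, h3⟩ := he.sep'
    rw [Bool.and_eq_true, Bool.and_eq_true, Bool.and_eq_true, Nat.blt_eq, ← hρ k l hk he.lt_n',
      ← hsep k l n hk he.lt_n']
    refine ⟨⟨⟨he.lt', (X.arc_adj _ _ he.arc').symm⟩, t, ht, h1, h2, ht.ne, h3⟩, ?_⟩
    by_contra hno
    simp only [Bool.not_eq_true', Bool.not_eq_false, Bool.and_eq_true, beq_iff_eq] at hno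
    have := he.arc'
    rw [← hno.1, ← hno.2] at this
    exact X.arc_asymm _ _ he.arc this
  rw [hij, Bool.not_true, Bool.false_or, List.all_eq_true] at h1
  have h2 := List.all_eq_true.1 (h1 k (List.mem_range.2 hk)) l (List.mem_range.2 he.lt_n')
  rw [hkl, Bool.not_true, Bool.false_or, Bool.or_eq_true] at h2
  rcases h2 with h2 | h2
  -- A superfluous vertex `v` is dropped: `e'` skips it and `sh` renumbers the other positions.
  -- Otherwise the configuration is in the table.
  · obtain ⟨v, hv, h3⟩ := List.any_eq_true.1 h2
    rw [List.mem_range] at hv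
    simp only [Bool.and_eq_true, Bool.or_eq_true, Bool.not_eq_true', beq_eq_false_iff_ne,
      beq_iff_eq, ← hsep i j v hi he.lt_n, ← hsep k l v hk he.lt_n'] at h3
    obtain ⟨⟨⟨⟨⟨⟨hvi, hvj⟩, hvk⟩, hvl⟩, hconn⟩, hs⟩, hs'⟩ := h3
    let e' : ℕ → V := fun a => if a < v then e a else e (a + 1)
    let sh : ℕ → ℕ := fun a => if a < v then a else a - 1
    have hsh : ∀ a, a ≠ v → e' (sh a) = e a := by
      intro a ha
      simp only [e', sh]
      split_ifs with h h'
      · rfl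
      · omega
      · congr 1
        omega
    have hshlt : ∀ a, a < n → a ≠ v → sh a < n - 1 := by
      intro a ha hav
      simp only [sh]
      split_ifs <;> omega
    have hshinj : ∀ a b, a ≠ v → b ≠ v → a < b → sh a < sh b := by
      intro a b ha hb hab
      simp only [sh]
      split_ifs <;> omega
    have hshne : ∀ a b, a ≠ v → b ≠ v → a ≠ b → sh a ≠ sh b := by
      intro a b ha hb hab
      rcases lt_or_gt_of_ne hab with h | h
      · exact (hshinj a b ha hb h).ne
      · exact (hshinj b a hb ha h).ne'
    refine ih (n - 1) (by omega) (by omega) e' (sh i) (sh j) (sh k) (sh l)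
      ⟨?_, ?_, hshinj _ _ hvi.symm hvj.symm he.lt, hshinj _ _ hvk.symm hvl.symm he.lt',
        hshlt _ he.lt_n hvj.symm, hshlt _ he.lt_n' hvl.symm, ?_, ?_, ?_, ?_⟩
    · intro a b hab hb
      simp only [e']
      split_ifs <;> exact he.mono _ _ (by omega) (by omega)
    · intro a ha
      simp only [e']
      rcases lt_trichotomy (a + 1) v with h | h | h
      · rw [if_pos (by omega), if_pos h]
        exact he.conn a (by omega)
      · rw [if_pos (by omega), if_neg (by omega), hρ _ _ (by omega) (by omega)]
        rcases hconn with (h' | h') | h'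
        · omega
        · omega
        · rwa [show v - 1 = a by omega, show v + 1 = a + 1 + 1 by omega] at h'
      · rw [if_neg (by omega), if_neg (by omega)]
        exact he.conn (a + 1) (by omega)
    · rw [hsh _ hvi.symm, hsh _ hvj.symm]
      exact he.arc
    · rw [hsh _ hvl.symm, hsh _ hvk.symm]
      exact he.arc'
    · obtain ⟨t, ht, t1, t2, t3, t4⟩ := hs
      refine ⟨sh t, hshlt t ht t3, hshne _ _ t3 hvi.symm t1, hshne _ _ t3 hvj.symm t2, ?_⟩
      rwa [hsh _ hvi.symm, hsh _ hvj.symm, hsh _ t3]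
    · obtain ⟨t, ht, t1, t2, t3, t4⟩ := hs'
      refine ⟨sh t, hshlt t ht t3, hshne _ _ t3 hvk.symm t1, hshne _ _ t3 hvl.symm t2, ?_⟩
      rwa [hsh _ hvk.symm, hsh _ hvl.symm, hsh _ t3]
  · obtain ⟨⟨ρ', ar, σ⟩, hrow, h3⟩ := List.any_eq_true.1 h2
    simp only [Bool.and_eq_true, beq_iff_eq] at h3
    obtain ⟨rfl, rfl⟩ := h3
    exact isListed_of_mem_tableRows hX he hlen hρ hrow

/-! ### Increasing induced paths -/

/-- `c 0 < c 1 < ⋯ < c k` is an induced path. -/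
def IsInducedChain [LinearOrder V] (G : SimpleGraph V) (c : ℕ → V) (k : ℕ) : Prop :=
  ∀ i j, i < j → j ≤ k → c i < c j ∧ (G.Adj (c i) (c j) ↔ j = i + 1)

section

variable [LinearOrder V] {G : SimpleGraph V} {c : ℕ → V} {k : ℕ}

theorem IsInducedChain.le (h : IsInducedChain G c k) {i j : ℕ} (hij : i ≤ j) (hj : j ≤ k) :
    c i ≤ c j := by
  rcases hij.lt_or_eq with hij | rfl
  · exact (h i j hij hj).1.le
  · exact le_rfl

theorem IsInducedChain.prepend (h : IsInducedChain G c k) {q : V} (hlt : q < c 0)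
    (hadj : G.Adj q (c 0)) (hn : ∀ i, 0 < i → i ≤ k → ¬ G.Adj q (c i)) :
    IsInducedChain G (fun i => if i = 0 then q else c (i - 1)) (k + 1) := by
  intro i j hij hj
  beta_reduce
  rw [if_neg (show ¬ j = 0 by omega)]
  by_cases hi : i = 0
  · rw [if_pos hi]
    refine ⟨hlt.trans_le (h.le (Nat.zero_le _) (by omega)), ?_⟩
    rcases Nat.eq_zero_or_pos (j - 1) with h0 | h0
    · rw [h0]
      exact iff_of_true hadj (by omega)
    · exact iff_of_false (hn _ h0 (by omega)) (by omega)
  · rw [if_neg hi]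
    obtain ⟨h1, h2⟩ := h (i - 1) (j - 1) (by omega) (by omega)
    refine ⟨h1, h2.trans (by omega)⟩

theorem IsInducedChain.append (h : IsInducedChain G c k) {r : V} (hlt : c k < r)
    (hadj : G.Adj (c k) r) (hn : ∀ i < k, ¬ G.Adj (c i) r) :
    IsInducedChain G (fun i => if i ≤ k then c i else r) (k + 1) := by
  intro i j hij hj
  beta_reduce
  rw [if_pos (show i ≤ k by omega)]
  by_cases hjk : j ≤ k
  · rw [if_pos hjk]
    exact h i j hij hjk
  · rw [if_neg hjk]
    refine ⟨(h.le (by omega) le_rfl).trans_lt hlt, ?_⟩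
    rcases Nat.lt_or_ge i k with hik | hik
    · exact iff_of_false (hn i hik) (by omega)
    · obtain rfl : i = k := by omega
      exact iff_of_true hadj (by omega)

/-- A vertex to the left of a chain and adjacent to its start can be made the start, after dropping
the old one if necessary. -/
theorem IsInducedChain.exists_extend_left (hG : IsStraight G) (h : IsInducedChain G c k) {q : V}
    (hlt : q < c 0) (hadj : G.Adj q (c 0)) : ∃ (k' : ℕ) (c' : ℕ → V), IsInducedChain G c' k' ∧
      c' 0 = q ∧ c' k' = c k ∧ 0 < k' ∧ c 0 ≤ c' 1 := by
  -- An edge from `q` beyond `c 1` would make `c 0` adjacent to `c i` by straightness. So only `c 1`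
  -- can be a second neighbour of `q`, and then `c 0` is dropped.
  have hn : ∀ i, 1 < i → i ≤ k → ¬ G.Adj q (c i) := by
    intro i hi hik hq
    have := (h 0 i (by omega) hik).2.1 (hG _ _ _ hlt (h 0 i (by omega) hik).1 hq).2
    omega
  by_cases h1 : 0 < k ∧ G.Adj q (c 1)
  · obtain ⟨hk, h1⟩ := h1
    have hs : IsInducedChain G (fun i => c (i + 1)) (k - 1) := by
      intro i j hij hj
      obtain ⟨h2, h3⟩ := h (i + 1) (j + 1) (by omega) (by omega)
      exact ⟨h2, h3.trans (by omega)⟩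
    refine ⟨_, _, hs.prepend (hlt.trans (h 0 1 (by omega) (by omega)).1) h1
      fun i hi hik => hn _ (by omega) (by omega), if_pos rfl, ?_, by omega, ?_⟩
    · rw [if_neg (by omega)]
      congr 1
      omega
    · simpa using (h 0 1 (by omega) (by omega)).1.le
  · refine ⟨_, _, h.prepend hlt hadj fun i hi hik => ?_, if_pos rfl, by simp, by omega, by simp⟩
    rcases (show i = 1 ∨ 1 < i by omega) with rfl | hi'
    · exact fun hq => h1 ⟨by omega, hq⟩
    · exact hn i hi' hik

/-- A vertex to the right of a chain and adjacent to its end can be made the end, after dropping the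
old one if necessary. -/
theorem IsInducedChain.exists_extend_right (hG : IsStraight G) (h : IsInducedChain G c k) {r : V}
    (hlt : c k < r) (hadj : G.Adj (c k) r) : ∃ (k' : ℕ) (c' : ℕ → V), IsInducedChain G c' k' ∧
      c' k' = r ∧ k' ≤ k + 1 ∧ k ≤ k' ∧ ∀ i < k', c' i = c i := by
  have hn : ∀ i, i + 1 < k → ¬ G.Adj (c i) r := by
    intro i hi hq
    have := (h i k (by omega) le_rfl).2.1 (hG _ _ _ (h i k (by omega) le_rfl).1 hlt hq).1
    omega
  by_cases h1 : 0 < k ∧ G.Adj (c (k - 1)) r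
  · obtain ⟨hk, h1⟩ := h1
    have hs : IsInducedChain G c (k - 1) := fun i j hij hj => h i j hij (by omega)
    refine ⟨_, _, hs.append ((h (k - 1) k (by omega) le_rfl).1.trans hlt) h1
      fun i hi => hn i (by omega), if_neg (by omega), by omega, by omega,
      fun i hi => if_pos (by omega)⟩
  · refine ⟨_, _, h.append hlt hadj fun i hi => ?_, if_neg (by omega), le_rfl, by omega,
      fun i hi => if_pos (by omega)⟩
    rcases (show i + 1 = k ∨ i + 1 < k by omega) with hi' | hi'
    · refine fun hq => h1 ⟨by omega, ?_⟩
      rwa [show k - 1 = i by omega]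
    · exact hn i hi'

/-- In a connected straight-ordered graph any two vertices are joined by an increasing induced
path. -/
theorem exists_isInducedChain [Finite V] (hG : IsStraight G) (hconn : G.Preconnected) (b : V) :
    ∀ a ≤ b, ∃ (k : ℕ) (c : ℕ → V), IsInducedChain G c k ∧ c 0 = a ∧ c k = b := by
  intro a
  induction a using WellFoundedGT.induction with
  | _ a ih =>
  intro hab
  rcases hab.lt_or_eq with hab | rfl
  · obtain ⟨u, w, hu, hw, huw⟩ : ∃ u w, u ≤ a ∧ a < w ∧ G.Adj u w := by
      by_contra! hno
      have hreach := (SimpleGraph.reachable_iff_reflTransGen a b).1 (hconn a b)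
      have : ∀ v, Relation.ReflTransGen G.Adj a v → v ≤ a := by
        intro v hv
        induction hv with
        | refl => exact le_rfl
        | tail _ h ih => exact le_of_not_gt fun hlt => hno _ _ ih hlt h
      exact absurd (this b hreach) (not_le_of_gt hab)
    have haw : G.Adj a w := by
      rcases hu.lt_or_eq with hu | rfl
      · exact (hG _ _ _ hu hw huw).2
      · exact huw
    -- Greedy choice: go from `a` to its last neighbour `a'` not beyond `b`. Then `a` is not
    -- adjacent to any later vertex of the path from `a'`.
    have hne : {v | G.Adj a v ∧ a < v ∧ v ≤ b}.Nonempty := by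
      rcases le_or_gt w b with hwb | hwb
      · exact ⟨w, haw, hw, hwb⟩
      · exact ⟨b, (hG _ _ _ hab hwb haw).1, hab, le_rfl⟩
    obtain ⟨a', ⟨h1, h2, h3⟩, hmax⟩ := (Set.toFinite _).exists_maximal hne
    obtain ⟨k, c, hc, rfl, hk⟩ := ih a' h2 h3
    refine ⟨k + 1, _, hc.prepend h2 h1 fun i hi hik hadj => ?_, if_pos rfl, by simp [hk]⟩
    have hlt := (hc 0 i hi hik).1
    exact absurd (hmax ⟨hadj, h2.trans hlt, hk ▸ hc.le hik le_rfl⟩ hlt.le) (not_le_of_gt hlt)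
  · exact ⟨0, fun _ => a, fun i j hij hj => by omega, rfl, rfl⟩

end

/-! ### Opposite arcs that are far apart -/

section

variable [LinearOrder V] {X : PartiallyOrientedGraph V} {c : ℕ → V} {k : ℕ}

theorem IsStraight.not_adj_of_le {G : SimpleGraph V} (hG : IsStraight G) {u v w : V}
    (huv : u < v) (hvw : v ≤ w) (h : ¬ G.Adj u v) : ¬ G.Adj u w := by
  rcases hvw.lt_or_eq with hvw | rfl
  · exact fun h' => h (hG _ _ _ huv hvw h').1
  · exact h

theorem IsStraight.not_adj_of_ge {G : SimpleGraph V} (hG : IsStraight G) {u v w : V}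
    (huv : u ≤ v) (hvw : v < w) (h : ¬ G.Adj v w) : ¬ G.Adj u w := by
  rcases huv.lt_or_eq with huv | rfl
  · exact fun h' => h (hG _ _ _ huv hvw h').2
  · exact h

theorem contains_pathArcs (hc : IsInducedChain X.graph c (k + 2)) (h1 : X.arc (c 0) (c 1))
    (h2 : X.arc (c (k + 2)) (c (k + 1))) : X.Contains (pathArcs k) := by
  refine contains_of_lt (fun a => c a.val) (fun a b hab => ?_) ?_
  · have hab' : a.val < b.val := hab
    obtain ⟨h3, h4⟩ := hc a.val b.val hab' (by omega)
    refine ⟨h3.ne, ?_⟩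
    rw [h4]
    refine SimpleGraph.pathGraph_adj.trans ?_
    omega
  · rintro a b (⟨ha, hb⟩ | ⟨ha, hb⟩) <;> rw [ha, hb]
    · exact h1
    · exact h2

/-- The vertices `x` and `p` become `0` and `1`, and the chain starts at `2`; the adjacency of `p`
and `c 1` is the extra edge `13`. Straightness excludes all other edges. -/
theorem contains_pathOneTriangle (hG : IsStraight X.graph)
    (hc : IsInducedChain X.graph c (k + 2)) {x p : V} (hxp : x < p) (hp : p < c 0)
    (hadj : X.graph.Adj x p) (hx : ¬ X.graph.Adj x (c 0)) (h1 : X.arc p (c 0))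
    (hp1 : X.graph.Adj p (c 1)) (h2 : X.arc (c (k + 2)) (c (k + 1))) :
    X.Contains (pathOneTriangle k) := by
  have hp2 : ∀ i, 1 < i → i ≤ k + 2 → ¬ X.graph.Adj p (c i) := by
    intro i hi hik h
    have := (hc 0 i (by omega) hik).2.1 (hG _ _ _ hp (hc 0 i (by omega) hik).1 h).2
    omega
  let g : ℕ → V := fun i => if i = 0 then x else if i = 1 then p else c (i - 2)
  have hg : ∀ i, 2 ≤ i → g i = c (i - 2) := fun i hi => by
    simp only [g]
    rw [if_neg (by omega), if_neg (by omega)]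
  refine contains_of_lt (fun a => g a.val) (fun a b hab => ?_) ?_
  · have hab' : a.val < b.val := hab
    have hb := b.isLt
    rw [pathOneTriangle_adj]
    generalize a.val = i at *
    generalize b.val = j at *
    rcases (show i = 0 ∨ i = 1 ∨ 2 ≤ i by omega) with rfl | rfl | hi
    · rcases (show j = 1 ∨ 2 ≤ j by omega) with rfl | hj
      · exact ⟨hxp.ne, iff_of_true (by omega) hadj⟩
      · rw [hg j hj]
        have hle := hc.le (Nat.zero_le (j - 2)) (by omega)
        exact ⟨((hxp.trans hp).trans_le hle).ne, iff_of_false (by omega)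
          (hG.not_adj_of_le (hxp.trans hp) hle hx)⟩
    · rw [hg j (by omega)]
      have hle := hc.le (Nat.zero_le (j - 2)) (by omega)
      refine ⟨(hp.trans_le hle).ne, ?_⟩
      rcases (show j = 2 ∨ j = 3 ∨ 4 ≤ j by omega) with rfl | rfl | hj
      · exact iff_of_true (by omega) (X.arc_adj _ _ h1)
      · exact iff_of_true (by omega) hp1
      · exact iff_of_false (by omega) (hp2 _ (by omega) (by omega))
    · rw [hg i hi, hg j (by omega)]
      obtain ⟨h3, h4⟩ := hc (i - 2) (j - 2) (by omega) (by omega)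
      refine ⟨h3.ne, ?_⟩
      rw [h4]
      omega
  · rintro a b (⟨ha, hb⟩ | ⟨ha, hb⟩) <;> rw [ha, hb]
    · exact h1
    · rw [hg _ (by omega), hg _ (by omega)]
      exact h2

theorem contains_pathTwoTriangles (hG : IsStraight X.graph)
    (hc : IsInducedChain X.graph c (k + 2)) {x p s y : V} (hxp : x < p) (hp : p < c 0)
    (hadj : X.graph.Adj x p) (hx : ¬ X.graph.Adj x (c 0)) (h1 : X.arc p (c 0))
    (hp1 : X.graph.Adj p (c 1)) (hs : c (k + 2) < s) (hsy : s < y) (hadj' : X.graph.Adj s y)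
    (hy : ¬ X.graph.Adj (c (k + 2)) y) (h2 : X.arc s (c (k + 2)))
    (hs1 : X.graph.Adj (c (k + 1)) s) : X.Contains (pathTwoTriangles k) := by
  have hp2 : ∀ i, 1 < i → i ≤ k + 2 → ¬ X.graph.Adj p (c i) := by
    intro i hi hik h
    have := (hc 0 i (by omega) hik).2.1 (hG _ _ _ hp (hc 0 i (by omega) hik).1 h).2
    omega
  have hs2 : ∀ i, i ≤ k → ¬ X.graph.Adj (c i) s := by
    intro i hik h
    have := (hc i (k + 2) (by omega) le_rfl).2.1
      (hG _ _ _ (hc i (k + 2) (by omega) le_rfl).1 hs h).1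
    omega
  let g : ℕ → V := fun i => if i = 0 then x else if i = 1 then p else if i ≤ k + 4 then c (i - 2)
    else if i = k + 5 then s else y
  have hg : ∀ i, 2 ≤ i → i ≤ k + 4 → g i = c (i - 2) := fun i hi hi' => by
    simp only [g]
    rw [if_neg (by omega), if_neg (by omega), if_pos hi']
  have hgs : g (k + 5) = s := by simp [g]
  have hgy : g (k + 6) = y := by simp [g]
  have hps : p < s := (hp.trans_le (hc.le (Nat.zero_le _) le_rfl)).trans hs
  have hcs : ∀ i, i ≤ k + 2 → c i < s := fun i hi => (hc.le hi le_rfl).trans_lt hs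
  have hxs : ¬ X.graph.Adj x s :=
    hG.not_adj_of_le (hxp.trans hp) (hcs 0 (by omega)).le hx
  have hcy : ∀ i, i ≤ k + 2 → ¬ X.graph.Adj (c i) y := fun i hi =>
    hG.not_adj_of_ge (hc.le hi le_rfl) (hs.trans hsy) hy
  refine contains_of_lt (fun a => g a.val) (fun a b hab => ?_) ?_
  · have hab' : a.val < b.val := hab
    have hb := b.isLt
    have hY : (pathTwoTriangles k).graph.Adj a b ↔ b.val = a.val + 1 ∨ (a.val = 1 ∧ b.val = 3) ∨
        (a.val = k + 3 ∧ b.val = k + 5) := by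
      simp only [pathTwoTriangles, SimpleGraph.sup_adj, SimpleGraph.pathGraph_adj,
        SimpleGraph.fromRel_adj, ne_eq, Fin.ext_iff]
      omega
    rw [hY]
    generalize a.val = i at *
    generalize b.val = j at *
    rcases (show j = 1 ∨ (2 ≤ j ∧ j ≤ k + 4) ∨ j = k + 5 ∨ j = k + 6 by omega) with
      rfl | ⟨hj, hj'⟩ | rfl | rfl
    · obtain rfl : i = 0 := by omega
      exact ⟨hxp.ne, iff_of_true (by omega) hadj⟩
    · rw [hg j hj hj']
      have hle := hc.le (Nat.zero_le (j - 2)) (by omega)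
      rcases (show i = 0 ∨ i = 1 ∨ 2 ≤ i by omega) with rfl | rfl | hi
      · exact ⟨((hxp.trans hp).trans_le hle).ne, iff_of_false (by omega)
          (hG.not_adj_of_le (hxp.trans hp) hle hx)⟩
      · refine ⟨(hp.trans_le hle).ne, ?_⟩
        rcases (show j = 2 ∨ j = 3 ∨ 4 ≤ j by omega) with rfl | rfl | hj
        · exact iff_of_true (by omega) (X.arc_adj _ _ h1)
        · exact iff_of_true (by omega) hp1
        · exact iff_of_false (by omega) (hp2 _ (by omega) (by omega))
      · rw [hg i hi (by omega)]
        obtain ⟨h3, h4⟩ := hc (i - 2) (j - 2) (by omega) (by omega)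
        refine ⟨h3.ne, ?_⟩
        rw [h4]
        omega
    · rw [hgs]
      rcases (show i = 0 ∨ i = 1 ∨ 2 ≤ i by omega) with rfl | rfl | hi
      · exact ⟨(hxp.trans hps).ne, iff_of_false (by omega) hxs⟩
      · exact ⟨hps.ne, iff_of_false (by omega) (hG.not_adj_of_le
          (hp.trans_le (hc.le (Nat.zero_le _) le_rfl)) hs.le (hp2 (k + 2) (by omega) le_rfl))⟩
      · rw [hg i hi (by omega)]
        refine ⟨(hcs _ (by omega)).ne, ?_⟩
        rcases (show i = k + 4 ∨ i = k + 3 ∨ i ≤ k + 2 by omega) with rfl | rfl | hi'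
        · exact iff_of_true (by omega) (X.arc_adj _ _ h2).symm
        · exact iff_of_true (by omega) hs1
        · exact iff_of_false (by omega) (hs2 _ (by omega))
    · rw [hgy]
      rcases (show i = 0 ∨ i = 1 ∨ (2 ≤ i ∧ i ≤ k + 4) ∨ i = k + 5 by omega) with
        rfl | rfl | ⟨hi, hi'⟩ | rfl
      · exact ⟨((hxp.trans hps).trans hsy).ne, iff_of_false (by omega)
          (hG.not_adj_of_le (hxp.trans hps) hsy.le hxs)⟩
      · exact ⟨(hps.trans hsy).ne, iff_of_false (by omega)
          (hG.not_adj_of_ge hp.le ((hcs 0 (by omega)).trans hsy) (hcy 0 (by omega)))⟩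
      · rw [hg i hi hi']
        exact ⟨((hcs _ (by omega)).trans hsy).ne, iff_of_false (by omega) (hcy _ (by omega))⟩
      · rw [hgs]
        exact ⟨hsy.ne, iff_of_true (by omega) hadj'⟩
  · rintro a b (⟨ha, hb⟩ | ⟨ha, hb⟩) <;> rw [ha, hb]
    · exact h1
    · rw [hgs, hg _ (by omega) (by omega)]
      exact h2

/-- `p → q` has a witness on the right and `s → r` one on the left. -/
theorem exists_contains_pathArcs [Finite V] (hG : IsStraight X.graph)
    (hconn : X.graph.Preconnected) {p q x r s y : V} (hpq : p < q) (hqx : q < x) (hxy : x < y)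
    (hyr : y < r) (hrs : r < s) (h1 : X.arc p q) (h2 : X.arc s r) (hx : X.graph.Adj q x)
    (hx' : ¬ X.graph.Adj p x) (hy : X.graph.Adj y r) (hy' : ¬ X.graph.Adj y s) :
    ∃ m, X.Contains (pathArcs m) := by
  -- A path from `x` to `y` is lengthened to one from `q` to `r`, possibly losing its old ends. The
  -- second vertex is still at or after `x`, so the witnesses keep `p` and `s` nonadjacent to
  -- everything but their neighbours `q` and `r`.
  obtain ⟨k, c, hc, rfl, rfl⟩ := exists_isInducedChain hG hconn y x hxy.le
  obtain ⟨k', c', hc', h0, hk', hpos, hc1⟩ := hc.exists_extend_left hG hqx hx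
  rw [← hk'] at hy hy' hyr
  obtain ⟨k'', c'', hc'', hr, hle, hle', heq⟩ := hc'.exists_extend_right hG hyr hy
  have h0' : c'' 0 = q := (heq 0 (by omega)).trans h0
  have hx1 : c 0 ≤ c'' 1 := by
    rcases Nat.lt_or_ge 1 k'' with h | h
    · rw [heq 1 h]
      exact hc1
    · obtain rfl : k'' = 1 := by omega
      rw [hr]
      exact (hxy.trans (hk' ▸ hyr)).le
  have hd := hc''.append (r := s) (by rwa [hr]) (by rw [hr]; exact (X.arc_adj _ _ h2).symm)
    fun i hi => by
      rw [heq i hi]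
      exact hG.not_adj_of_ge (hc'.le (by omega) le_rfl) (hyr.trans hrs) hy'
  have hd' := hd.prepend (q := p) (by simpa [h0'] using hpq)
    (by simpa [h0'] using X.arc_adj _ _ h1) fun i hi hik => by
      refine hG.not_adj_of_le (hpq.trans hqx) (hx1.trans ?_) hx'
      have := hd.le (i := 1) (j := i) (by omega) (by omega)
      simpa [show 1 ≤ k'' by omega] using this
  refine ⟨k'', contains_pathArcs hd' ?_ ?_⟩
  · simpa [h0'] using h1
  · simpa [hr] using h2

/-- `p → q` has only witnesses on the left and `s → r` has one on the left. -/
theorem exists_contains_pathOneTriangle [Finite V] (hG : IsStraight X.graph)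
    (hconn : X.graph.Preconnected) {p q x r s y : V} (hxp : x < p) (hpq : p < q) (hqy : q < y)
    (hyr : y < r) (hrs : r < s) (h1 : X.arc p q) (h2 : X.arc s r) (hx : X.graph.Adj x p)
    (hx' : ¬ X.graph.Adj x q) (hno : ∀ w, q < w → X.graph.Adj q w → X.graph.Adj p w)
    (hy : X.graph.Adj y r) (hy' : ¬ X.graph.Adj y s) : ∃ m, X.Contains (pathOneTriangle m) := by
  obtain ⟨k, c, hc, rfl, rfl⟩ := exists_isInducedChain hG hconn y q hqy.le
  have hk : 0 < k := by
    rcases Nat.eq_zero_or_pos k with rfl | h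
    · exact absurd hqy (lt_irrefl _)
    · exact h
  obtain ⟨k', c', hc', hr, hle, hle', heq⟩ := hc.exists_extend_right hG hyr hy
  have h0 : c' 0 = c 0 := heq 0 (by omega)
  have hd := hc'.append (r := s) (by rwa [hr]) (by rw [hr]; exact (X.arc_adj _ _ h2).symm)
    fun i hi => by
      rw [heq i hi]
      exact hG.not_adj_of_ge (hc.le (by omega) le_rfl) (hyr.trans hrs) hy'
  obtain ⟨m, rfl⟩ : ∃ m, k' = m + 1 := ⟨k' - 1, by omega⟩
  obtain ⟨h3, h4⟩ := hc' 0 1 (by omega) (by omega)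
  refine ⟨m, contains_pathOneTriangle hG hd hxp ?_ hx ?_ ?_ ?_ ?_⟩
  · simpa [h0] using hpq
  · simpa [h0] using hx'
  · simpa [h0] using h1
  -- The absence of right witnesses makes `p` adjacent to the second vertex of the chain, closing
  -- the triangle.
  · rw [h0] at h3 h4
    simpa using hno _ h3 (h4.2 rfl)
  · simpa [hr] using h2

/-- `p → q` has only witnesses on the left and `s → r` has only witnesses on the right. -/
theorem exists_contains_pathTwoTriangles [Finite V] (hG : IsStraight X.graph)
    (hconn : X.graph.Preconnected) {p q x r s y : V} (hxp : x < p) (hpq : p < q) (hqr : q < r)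
    (hrs : r < s) (hsy : s < y) (h1 : X.arc p q) (h2 : X.arc s r) (hx : X.graph.Adj x p)
    (hx' : ¬ X.graph.Adj x q) (hno : ∀ w, q < w → X.graph.Adj q w → X.graph.Adj p w)
    (hy : X.graph.Adj s y) (hy' : ¬ X.graph.Adj r y)
    (hno' : ∀ w, w < r → X.graph.Adj w r → X.graph.Adj w s) (hqr' : ¬ X.graph.Adj q r) :
    ∃ m, X.Contains (pathTwoTriangles m) := by
  obtain ⟨k, c, hc, rfl, rfl⟩ := exists_isInducedChain hG hconn r q hqr.le
  have hk : 2 ≤ k := by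
    by_contra hlt
    rcases (show k = 0 ∨ k = 1 by omega) with rfl | rfl
    · exact lt_irrefl _ hqr
    · exact hqr' ((hc 0 1 (by omega) le_rfl).2.2 rfl)
  obtain ⟨m, rfl⟩ : ∃ m, k = m + 2 := ⟨k - 2, by omega⟩
  obtain ⟨h3, h4⟩ := hc 0 1 (by omega) (by omega)
  obtain ⟨h5, h6⟩ := hc (m + 1) (m + 2) (by omega) (by omega)
  exact ⟨m, contains_pathTwoTriangles hG hc hxp hpq hx hx' h1 (hno _ h3 (h4.2 rfl)) hrs hsy hy hy'
    h2 (hno' _ h5 (h6.2 rfl))⟩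

/-- `x` is adjacent to exactly one end of `pq`, where `p < q`. -/
def IsWitness (G : SimpleGraph V) (p q x : V) : Prop :=
  (x < p ∧ G.Adj x p ∧ ¬ G.Adj x q) ∨ (q < x ∧ G.Adj q x ∧ ¬ G.Adj p x)

theorem exists_isWitness {G : SimpleGraph V} (hG : IsStraight G) {p q : V} (hpq : p < q)
    (hadj : G.Adj p q) (h : closedNbhd G p ≠ closedNbhd G q) : ∃ x, IsWitness G p q x := by
  by_contra! hno
  apply h
  have h1 : ∀ x, x < p → G.Adj x p → G.Adj x q := fun x hx hxp => by
    by_contra hn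
    exact hno x (Or.inl ⟨hx, hxp, hn⟩)
  have h2 : ∀ x, q < x → G.Adj q x → G.Adj p x := fun x hx hqx => by
    by_contra hn
    exact hno x (Or.inr ⟨hx, hqx, hn⟩)
  ext x
  rcases lt_trichotomy x p with hx | rfl | hx
  · refine or_congr (iff_of_false hx.ne (hx.trans hpq).ne) ⟨fun h => (h1 x hx h.symm).symm,
      fun h => (hG _ _ _ hx hpq h.symm).1.symm⟩
  · exact iff_of_true (Or.inl rfl) (Or.inr hadj.symm)
  · rcases lt_trichotomy x q with hx' | rfl | hx'
    · exact iff_of_true (Or.inr (hG _ _ _ hx hx' hadj).1) (Or.inr (hG _ _ _ hx hx' hadj).2.symm)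
    · exact iff_of_true (Or.inr hadj) (Or.inl rfl)
    · exact or_congr (iff_of_false hx.ne' hx'.ne') ⟨fun h => (hG _ _ _ hpq hx' h).2,
        fun h => h2 x hx' h⟩

end

/-! ### Opposite arcs: choice of witnesses, near and far case. -/

theorem IsStraight.orderDual [L : LinearOrder V] {G : SimpleGraph V} (hG : IsStraight G) :
    @IsStraight V (inferInstanceAs (LinearOrder Vᵒᵈ)) G :=
  fun u v w huv hvw huw => ⟨(hG w v u hvw huv huw.symm).2.symm, (hG w v u hvw huv huw.symm).1.symm⟩

/-- A witness on the side facing the other arc is preferred. If there is none, the extra information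
that all right neighbours of `q` are neighbours of `p` supplies the triangle of the path families.
`exists_isWitness_left` is the mirror image. -/
theorem exists_isWitness_right {G : SimpleGraph V} [LinearOrder V] (hG : IsStraight G) {p q : V}
    (hpq : p < q) (hadj : G.Adj p q) (h : closedNbhd G p ≠ closedNbhd G q) :
    ∃ x, (q < x ∧ G.Adj q x ∧ ¬ G.Adj p x) ∨
      (x < p ∧ G.Adj x p ∧ ¬ G.Adj x q ∧ ∀ w, q < w → G.Adj q w → G.Adj p w) := by
  by_cases hw : ∃ w, q < w ∧ G.Adj q w ∧ ¬ G.Adj p w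
  · exact hw.imp fun w hw => Or.inl hw
  · push Not at hw
    obtain ⟨x, hx | hx⟩ := exists_isWitness hG hpq hadj h
    · exact ⟨x, Or.inr ⟨hx.1, hx.2.1, hx.2.2, hw⟩⟩
    · exact absurd (hw x hx.1 hx.2.1) hx.2.2

theorem exists_isWitness_left {G : SimpleGraph V} [LinearOrder V] (hG : IsStraight G) {r s : V}
    (hrs : r < s) (hadj : G.Adj r s) (h : closedNbhd G r ≠ closedNbhd G s) :
    ∃ y, (y < r ∧ G.Adj y r ∧ ¬ G.Adj y s) ∨
      (s < y ∧ G.Adj s y ∧ ¬ G.Adj r y ∧ ∀ w, w < r → G.Adj w r → G.Adj w s) := by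
  by_cases hw : ∃ w, w < r ∧ G.Adj w r ∧ ¬ G.Adj w s
  · exact hw.imp fun w hw => Or.inl hw
  · push Not at hw
    obtain ⟨x, hx | hx⟩ := exists_isWitness hG hrs hadj h
    · exact absurd (hw x hx.1 hx.2.1) hx.2.2
    · exact ⟨x, Or.inr ⟨hx.1, hx.2.1, hx.2.2, hw⟩⟩

/-- Two opposite unbalanced arcs, the forward one far to the left of the other one. -/
theorem isListed_of_far [LinearOrder V] [Finite V] {X : PartiallyOrientedGraph V}
    (hX : X.IsObstruction) (hG : IsStraight X.graph) {p q x r s y : V} (hpq : p < q) (hrs : r < s)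
    (h1 : X.arc p q) (h2 : X.arc s r)
    (hx : (q < x ∧ X.graph.Adj q x ∧ ¬ X.graph.Adj p x) ∨
      (x < p ∧ X.graph.Adj x p ∧ ¬ X.graph.Adj x q ∧
        ∀ w, q < w → X.graph.Adj q w → X.graph.Adj p w))
    (hy : (y < r ∧ X.graph.Adj y r ∧ ¬ X.graph.Adj y s) ∨
      (s < y ∧ X.graph.Adj s y ∧ ¬ X.graph.Adj r y ∧
        ∀ w, w < r → X.graph.Adj w r → X.graph.Adj w s))
    (hxy : x < y) (hxr : x < r) (hqy : q < y) (hqr : q < r) (hn : ¬ X.graph.Adj q r) :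
    X.IsListed := by
  have hconn := hX.preconnected
  have nloc : X.IsListedNotLocallyCompletable → X.IsListed := fun h => Or.inr (Or.inr (Or.inr h))
  have hone : (∃ m, X.Contains (pathOneTriangle m)) → X.IsListed := by
    rintro ⟨m, hm⟩
    have := hX.isomorphic_of_contains hm (pathOneTriangle_not_completable m)
    refine nloc ?_
    unfold IsListedNotLocallyCompletable
    exact Or.inr (Or.inr (Or.inr (Or.inr (Or.inl ⟨m, this⟩))))
  rcases hx with ⟨hx1, hx2, hx3⟩ | ⟨hx1, hx2, hx3, hx4⟩ <;>
    rcases hy with ⟨hy1, hy2, hy3⟩ | ⟨hy1, hy2, hy3, hy4⟩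
  · obtain ⟨m, hm⟩ := exists_contains_pathArcs hG hconn hpq hx1 hxy hy1 hrs h1 h2 hx2 hx3 hy2 hy3
    have := hX.isomorphic_of_contains hm (pathArcs_not_completable m)
    refine nloc ?_
    unfold IsListedNotLocallyCompletable
    exact Or.inr (Or.inr (Or.inr (Or.inr (Or.inr (Or.inl ⟨m, this⟩)))))
  -- The mirror image of the next case: in the reversed ordering the two arcs exchange roles.
  · exact hone (@exists_contains_pathOneTriangle V (inferInstanceAs (LinearOrder Vᵒᵈ)) X _
      hG.orderDual hconn s r y q p x hy1 hrs hxr hx1 hpq h2 h1 hy2.symm (fun h => hy3 h.symm)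
      (fun w hw h => (hy4 w hw h.symm).symm) hx2.symm fun h => hx3 h.symm)
  · exact hone (exists_contains_pathOneTriangle hG hconn hx1 hpq hqy hy1 hrs h1 h2 hx2 hx3 hx4 hy2
      hy3)
  · obtain ⟨m, hm⟩ := exists_contains_pathTwoTriangles hG hconn hx1 hpq hqr hrs hy1 h1 h2 hx2 hx3
      hx4 hy2 hy3 hy4 hn
    have := hX.isomorphic_of_contains hm (pathTwoTriangles_not_completable m)
    refine nloc ?_
    unfold IsListedNotLocallyCompletable
    exact Or.inr (Or.inr (Or.inr (Or.inr (Or.inr (Or.inr (Or.inr ⟨m, this⟩))))))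

/-- Two unbalanced arcs in opposite directions. -/
theorem isListed_of_opposite_of_le [LinearOrder V] [Finite V] {X : PartiallyOrientedGraph V}
    (hX : X.IsObstruction) (hG : IsStraight X.graph) {p q r s : V} (hpq : p < q) (hrs : r < s)
    (h1 : X.arc p q) (h2 : X.arc s r) (hpq' : closedNbhd X.graph p ≠ closedNbhd X.graph q)
    (hrs' : closedNbhd X.graph r ≠ closedNbhd X.graph s) (hpr : p ≤ r) :
    X.IsListed ∨ X.dual.IsListed := by
  have hapq := X.arc_adj _ _ h1
  have hars := (X.arc_adj _ _ h2).symm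
  obtain ⟨x, hx⟩ := exists_isWitness_right hG hpq hapq hpq'
  obtain ⟨y, hy⟩ := exists_isWitness_left hG hrs hars hrs'
  -- The two arcs and their witnesses, listed increasingly by `f`; the value `p` beyond `S.card` is
  -- irrelevant.
  let S : Finset V := {p, q, x, r, s, y}
  let e := S.orderEmbOfFin rfl
  let f : ℕ → V := fun i => if h : i < S.card then e ⟨i, h⟩ else p
  have hf : ∀ i (h : i < S.card), f i = e ⟨i, h⟩ := fun i h => dif_pos h
  have hmono : ∀ a b, a < b → b < S.card → f a < f b := by
    intro a b hab hb
    rw [hf a (hab.trans hb), hf b hb]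
    exact e.strictMono hab
  have hex : ∀ v ∈ S, ∃ i < S.card, f i = v := by
    intro v hv
    have : v ∈ Set.range e := by
      rw [Finset.range_orderEmbOfFin]
      exact hv
    obtain ⟨i, hi⟩ := this
    exact ⟨i.val, i.isLt, by rw [hf i.val i.isLt]; exact hi⟩
  have hfS : ∀ i < S.card, f i ∈ S := by
    intro i hi
    rw [hf i hi]
    exact Finset.orderEmbOfFin_mem _ _ _
  have hmono' : ∀ a b, a < S.card → b < S.card → f a < f b → a < b := by
    intro a b ha hb hab
    by_contra hle
    rcases (Nat.le_of_not_lt hle).lt_or_eq with h | rfl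
    · exact absurd hab (hmono _ _ h ha).asymm
    · exact lt_irrefl _ hab
  have hcard : S.card ≤ 6 := Finset.card_le_six
  by_cases hcon : ∀ a, a + 1 < S.card → X.graph.Adj (f a) (f (a + 1))
  · obtain ⟨i, hi, ei⟩ := hex p (by simp [S])
    obtain ⟨j, hj, ej⟩ := hex q (by simp [S])
    obtain ⟨k, hk, ek⟩ := hex r (by simp [S])
    obtain ⟨l, hl, el⟩ := hex s (by simp [S])
    obtain ⟨t, ht, et⟩ := hex x (by simp [S])
    obtain ⟨u, hu, eu⟩ := hex y (by simp [S])
    refine isListed_of_isConfig hX hG _ hcard f i j k l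
      ⟨hmono, hcon, hmono' _ _ hi hj (by rwa [ei, ej]), hmono' _ _ hk hl (by rwa [ek, el]), hj, hl,
        by rwa [ei, ej], by rwa [el, ek], ⟨t, ht, ?_⟩, ⟨u, hu, ?_⟩⟩
    · rw [ei, ej, et]
      rcases hx with ⟨a1, a2, a3⟩ | ⟨a1, a2, a3, -⟩
      · exact ⟨fun h => ((hpq.trans a1).ne (by rw [← ei, ← et, h])).elim,
          fun h => (a1.ne (by rw [← ej, ← et, h])).elim, fun h => a3 (h.2 a2)⟩
      · exact ⟨fun h => (a1.ne (by rw [← ei, ← et, h])).elim,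
          fun h => ((a1.trans hpq).ne (by rw [← ej, ← et, h])).elim, fun h => a3 (h.1 a2.symm).symm⟩
    · rw [ek, el, eu]
      rcases hy with ⟨a1, a2, a3⟩ | ⟨a1, a2, a3, -⟩
      · exact ⟨fun h => (a1.ne (by rw [← ek, ← eu, h])).elim,
          fun h => ((a1.trans hrs).ne (by rw [← el, ← eu, h])).elim, fun h => a3 (h.1 a2.symm).symm⟩
      · exact ⟨fun h => ((hrs.trans a1).ne (by rw [← ek, ← eu, h])).elim,
          fun h => (a1.ne (by rw [← el, ← eu, h])).elim, fun h => a3 (h.2 a2)⟩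
  · push Not at hcon
    -- Two consecutive vertices are nonadjacent, so by straightness no edge crosses this cut. Each
    -- arc and its witness span a connected part, hence lie on one side; both sides are nonempty,
    -- and `p ≤ r` puts `p`, `q`, `x` on the left and `r`, `s`, `y` on the right.
    obtain ⟨a, ha, hcut⟩ := hcon
    have hside : ∀ v ∈ S, v ≤ f a ∨ f (a + 1) ≤ v := by
      intro v hv
      obtain ⟨i, hi, ei⟩ := hex v hv
      rw [← ei]
      rcases Nat.lt_or_ge a i with h | h
      · right
        rcases (show a + 1 < i ∨ a + 1 = i by omega) with h | rfl
        · exact (hmono _ _ h hi).le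
        · exact le_rfl
      · left
        rcases h.lt_or_eq with h | rfl
        · exact (hmono _ _ h (by omega)).le
        · exact le_rfl
    have hlt := hmono a (a + 1) (by omega) ha
    have hcross : ∀ u w, u ≤ f a → f (a + 1) ≤ w → u < w ∧ ¬ X.graph.Adj u w := fun u w hu hw =>
      ⟨(hu.trans_lt hlt).trans_le hw,
        hG.not_adj_of_le (hu.trans_lt hlt) hw (hG.not_adj_of_ge hu hlt hcut)⟩
    have hsame : ∀ u ∈ S, ∀ w ∈ S, X.graph.Adj u w → u ≤ f a → w ≤ f a := by
      intro u hu w hw huw hua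
      exact (hside w hw).resolve_right fun h => (hcross u w hua h).2 huw
    have mp : p ∈ S := by simp [S]
    have mq : q ∈ S := by simp [S]
    have mx : x ∈ S := by simp [S]
    have mr : r ∈ S := by simp [S]
    have ms : s ∈ S := by simp [S]
    have my : y ∈ S := by simp [S]
    have hA : (p ≤ f a ↔ q ≤ f a) ∧ (p ≤ f a ↔ x ≤ f a) := by
      have h3 : p ≤ f a ↔ q ≤ f a := ⟨hsame p mp q mq hapq, hsame q mq p mp hapq.symm⟩
      refine ⟨h3, ?_⟩
      rcases hx with ⟨_, h, _⟩ | ⟨_, h, _⟩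
      · exact h3.trans ⟨hsame q mq x mx h, hsame x mx q mq h.symm⟩
      · exact ⟨hsame p mp x mx h.symm, hsame x mx p mp h⟩
    have hB : (r ≤ f a ↔ s ≤ f a) ∧ (r ≤ f a ↔ y ≤ f a) := by
      have h3 : r ≤ f a ↔ s ≤ f a := ⟨hsame r mr s ms hars, hsame s ms r mr hars.symm⟩
      refine ⟨h3, ?_⟩
      rcases hy with ⟨_, h, _⟩ | ⟨_, h, _⟩
      · exact ⟨hsame r mr y my h.symm, hsame y my r mr h⟩
      · exact h3.trans ⟨hsame s ms y my h, hsame y my s ms h.symm⟩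
    have hcases : ∀ v ∈ S, (v ≤ f a ↔ p ≤ f a) ∨ (v ≤ f a ↔ r ≤ f a) := by
      intro v hv
      simp only [S, Finset.mem_insert, Finset.mem_singleton] at hv
      rcases hv with h | h | h | h | h | h <;> rw [h]
      · exact Or.inl Iff.rfl
      · exact Or.inl hA.1.symm
      · exact Or.inl hA.2.symm
      · exact Or.inr Iff.rfl
      · exact Or.inr hB.1.symm
      · exact Or.inr hB.2.symm
    have hpa : p ≤ f a := by
      rcases hcases _ (hfS a (by omega)) with h | h
      · exact h.1 le_rfl
      · exact hpr.trans (h.1 le_rfl)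
    have hra : ¬ r ≤ f a := by
      intro hra
      rcases hcases _ (hfS (a + 1) ha) with h | h
      · exact absurd (h.2 hpa) (not_le_of_gt hlt)
      · exact absurd (h.2 hra) (not_le_of_gt hlt)
    have hr := (hside r mr).resolve_left hra
    have hy' := (hside y my).resolve_left fun h => hra (hB.2.2 h)
    have hq := hA.1.1 hpa
    have hx' := hA.2.1 hpa
    exact Or.inl (isListed_of_far hX hG hpq hrs h1 h2 hx hy (hcross _ _ hx' hy').1
      (hcross _ _ hx' hr).1 (hcross _ _ hq hy').1 (hcross _ _ hq hr).1 (hcross _ _ hq hr).2)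

theorem isListed_of_opposite [LinearOrder V] [Finite V] {X : PartiallyOrientedGraph V}
    (hX : X.IsObstruction) (hG : IsStraight X.graph) {p q r s : V} (hpq : p < q) (hrs : r < s)
    (h1 : X.arc p q) (h2 : X.arc s r) (hpq' : closedNbhd X.graph p ≠ closedNbhd X.graph q)
    (hrs' : closedNbhd X.graph r ≠ closedNbhd X.graph s) : X.IsListed ∨ X.dual.IsListed := by
  rcases le_total p r with h | h
  · exact isListed_of_opposite_of_le hX hG hpq hrs h1 h2 hpq' hrs' h
  -- Dualising reverses both arcs, so the one that starts further left becomes the forward arc.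
  · exact (isListed_of_opposite_of_le hX.dual hG hrs hpq h2 h1 hrs' hpq' h).symm

end PartiallyOrientedGraph

/-! ### The theorem. -/

open PartiallyOrientedGraph in
theorem theorem1p2 {V : Type*} [Finite V] (X : PartiallyOrientedGraph V)
    (hX : X.IsObstruction) : X.IsListed ∨ X.dual.IsListed := by
  by_cases hU : X.IsUnobstructed
  · obtain ⟨L, hG⟩ := hU.exists_isStraight hX.preconnected
    by_cases hcyc : ∃ v, Relation.TransGen
        (fun a b => X.arc a b ∧ closedNbhd X.graph a = closedNbhd X.graph b) v v
    · obtain ⟨v, hv⟩ := hcyc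
      obtain ⟨k, hk, h⟩ := contains_cyclicClique (X := X) (fun u v h => h.1) (fun u v h hne => by
        have hN : closedNbhd X.graph u = closedNbhd X.graph v := by
          clear hne
          induction h with
          | single h => exact h.2
          | tail _ h ih => exact ih.trans h.2
        have hmem : v ∈ closedNbhd X.graph u := by
          rw [hN]
          exact Or.inl rfl
        exact hmem.resolve_left hne.symm) hv
      have := hX.isomorphic_of_contains h (cyclicClique_not_completable k hk)
      refine Or.inl (Or.inr (Or.inr (Or.inl ?_)))
      unfold IsListedLocallyCompletable
      exact Or.inr (Or.inr (Or.inr (Or.inr (Or.inr (Or.inr (Or.inr ⟨k, hk, this⟩))))))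
    push Not at hcyc
    -- If all arcs between different classes agree with the ordering, or all agree with its reverse,
    -- there is a completion. Hence there is one arc of each direction.
    by_cases hfw : ∀ u v, X.arc u v → closedNbhd X.graph u ≠ closedNbhd X.graph v → u < v
    · exact absurd (completable_of_isStraight hG hfw hcyc) hX.1
    by_cases hbw : ∀ u v, X.arc u v → closedNbhd X.graph u ≠ closedNbhd X.graph v → v < u
    · exact absurd (@completable_of_isStraight V (inferInstanceAs (LinearOrder Vᵒᵈ)) X
        hG.orderDual hbw hcyc) hX.1
    push Not at hfw hbw
    obtain ⟨s, r, hsr, hN, hle⟩ := hfw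
    obtain ⟨p, q, hpq, hN', hle'⟩ := hbw
    exact isListed_of_opposite hX hG (lt_of_le_of_ne hle' (X.arc_adj _ _ hpq).ne)
      (lt_of_le_of_ne hle (X.arc_adj _ _ hsr).ne') hpq hsr hN' hN.symm
  · left
    by_contra hL
    refine hU ⟨fun k hk h => hL (Or.inl ⟨k, hk, ?_⟩), fun h => hL (Or.inr (Or.inl ?_)),
      fun h => hL (Or.inr (Or.inl ?_)), fun h => hL (Or.inr (Or.inl ?_))⟩
    · exact hX.isomorphic_of_contains h (cycleGraph_not_completable k hk)
    · exact Or.inr (Or.inl (hX.isomorphic_of_contains h claw_not_completable))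
    · exact Or.inr (Or.inr (hX.isomorphic_of_contains h net_not_completable))
    · exact Or.inl (hX.isomorphic_of_contains h tent_not_completable)
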